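/- Let $0<q<1$ and put $[n]_q=\frac{1-q^n}{1-q}$, $D_qf(x)=\frac{f(x)-f(qx)}{(1-q)x}$ for $x\ne 0$, and $(y;q)_k=\prod_{j=0}^{k-1}(1-yq^j)$. For $a\neq 0$ let $$U_n^{(a)}(x;q)=(-a)^nq^{\binom n2}\,{}_2\phi_1\!\left(q^{-n},x^{-1};0;q;\tfrac{qx}{a}\right)=(-a)^nq^{\binom n2}\sum_{k=0}^{n}\frac{(q^{-n};q)_k\,(x^{-1};q)_k}{(q;q)_k}\left(\frac{qx}{a}\right)^k\qquad(x\ne 0)$$ be the Al-Salam–Carlitz I polynomials. Let $\{Q_n\}_{n\ge 0}$ be a set of monic real polynomials with $\deg Q_n=n$. The following are equivalent. (i) $\{Q_n\}$ is quasi-orthogonal, that is, there are an interval $I\subseteq\mathbb R$ (bounded or not) and a non-decreasing function $w$ such that all moments of $dw$ over $I$ are finite and $\int_I x^mQ_n(x)\,dw(x)$ is $0$ for $0\le m\le n-2$, is nonzero for $0\le m=n-1$, and is nonzero for $m=n=0$; and $\{Q_n\}$ is a $q$-Appell set, that is, $D_qQ_n(x)=[n]_qQ_{n-1}(x)$ for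 all $n\ge 0$ (the right-hand side being $0$ for $n=0$) and all $x\neq 0$. (ii) There are real constants $\alpha,\beta,\lambda$ with $\beta\ne0$, $\lambda\neq 0$ and $\alpha/\beta<0$ such that for all $n\ge1$ (and all $x\ne0$) $$Q_n(x)=\beta^n U_n^{(\alpha/\beta)}\!\left(\frac x\beta;q\right)-\frac{\beta^n[n]_q}{\lambda}\,U_{n-1}^{(\alpha/\beta)}\!\left(\frac x\beta;q\right).$$ -/

import Mathlib

open MeasureTheory

noncomputable section

/-- The `q`-number `[n]_q = (1 - q^n) / (1 - q)`. -/
def qNumber (q : ℝ) (n : ℕ) : ℝ := (1 - q ^ n) / (1 - q)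

/-- The Hahn derivative `D_q f (x) = (f x - f (q x)) / ((1 - q) x)`; it is only used at `x ≠ 0`. -/
def hahnDeriv (q : ℝ) (f : ℝ → ℝ) (x : ℝ) : ℝ := (f x - f (q * x)) / ((1 - q) * x)

/-- The `q`-Pochhammer symbol `(a; q)_n = (1 - a) (1 - a q) ⋯ (1 - a q^(n-1))`. -/
def qPochhammer (a q : ℝ) (n : ℕ) : ℝ := ∏ j ∈ Finset.range n, (1 - a * q ^ j)

/-- The basic hypergeometric series `_rφ_s (as; bs; q; z)`, where `r` and `s` are the lengths of
the parameter lists `as` and `bs`. -/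
def basicHypergeometric (as bs : List ℝ) (q z : ℝ) : ℝ :=
  ∑' k : ℕ, (as.map fun a => qPochhammer a q k).prod / (bs.map fun b => qPochhammer b q k).prod *
    ((-1) ^ k * q ^ k.choose 2) ^ (1 + (bs.length : ℤ) - (as.length : ℤ)) *
    (z ^ k / qPochhammer q q k)

/-- The Al-Salam–Carlitz I polynomial
`U_n^{(a)}(x; q) = (-a)^n q^(n choose 2) ₂φ₁(q^{-n}, x^{-1}; 0; q; q x / a)`, for `a ≠ 0`, `x ≠ 0`.
The series terminates, because `(q^{-n}; q)_k = 0` for `k > n`. -/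
def alSalamCarlitzI (n : ℕ) (a x q : ℝ) : ℝ :=
  (-a) ^ n * q ^ n.choose 2 *
    basicHypergeometric [(q ^ n)⁻¹, x⁻¹] [0] q (q * x / a)

/-- A polynomial set: `deg Q_n = n` for every `n`. -/
def IsPolynomialSet (Q : ℕ → Polynomial ℝ) : Prop := ∀ n, (Q n).degree = n

/-- Quasi-orthogonality: there are an interval `I` (bounded or not) and a non-decreasing function
`w` such that all moments of `dw` over `I` exist and `∫_I x^m Q_n(x) dw(x)` vanishes for
`0 ≤ m ≤ n - 2`, and does not vanish for `0 ≤ m = n - 1` and for `m = n = 0`.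
Here `dw` is the Lebesgue–Stieltjes measure of (the right-continuous version of) `w`. -/
def IsQuasiOrthogonal (Q : ℕ → Polynomial ℝ) : Prop :=
  IsPolynomialSet Q ∧
  ∃ (I : Set ℝ) (w : ℝ → ℝ) (hw : Monotone w), I.OrdConnected ∧
    (∀ k : ℕ, IntegrableOn (fun x : ℝ => x ^ k) I hw.stieltjesFunction.measure) ∧
    (∀ n m : ℕ, m + 2 ≤ n →
      ∫ x in I, x ^ m * (Q n).eval x ∂hw.stieltjesFunction.measure = 0) ∧
    (∀ n m : ℕ, m + 1 = n →
      ∫ x in I, x ^ m * (Q n).eval x ∂hw.stieltjesFunction.measure ≠ 0) ∧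
    ∫ x in I, (Q 0).eval x ∂hw.stieltjesFunction.measure ≠ 0

/-- A `q`-Appell set: a polynomial set with `D_q Q_n = [n]_q Q_{n-1}` for `n = 0, 1, 2, …`
(for `n = 0` the right-hand side is `0`, since `[0]_q = 0`). -/
def IsQAppell (q : ℝ) (Q : ℕ → Polynomial ℝ) : Prop :=
  IsPolynomialSet Q ∧
  ∀ n : ℕ, ∀ x : ℝ, x ≠ 0 →
    hahnDeriv q (fun y => (Q n).eval y) x = qNumber q n * (Q (n - 1)).eval x

end

/-! Write σ for the substitution X ↦ qX and (yX)_∞ for `qPochhammerSeries q y`. A q-Appell set is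
encoded by one series A through Σ Q_n(x) Xⁿ/(q;q)_n = A(X)/(xX)_∞, and (ii) becomes A = (1 -
κX)(aX)_∞(bX)_∞ with ab < 0 and κ ≠ 0 (`exists_alSalamCarlitz_iff`). If M_j is the generating series
of the moments shifted by j, quasi-orthogonality says that each A·M_j is a polynomial of degree
exactly j + 1 and that m₀ ≠ 0 (`integral_pow_mul_eval`).

From (i) to (ii): X·M_{j+1} = M_j - σM_j, so A·σM_0 and A·σ²M_0 are polynomials as well. Evaluating
an identity between them at the zero of σ(A·M_0) yields a quadratic d, d(0) = 1, with σM_0 = d·M_0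
or A = d·σA (`quad_dichotomy`). Positivity of the measure makes the X² coefficient of d negative, so
d = (1 - aX)(1 - bX) with ab < 0. In the first case M_0 = m₀/((aX)_∞(bX)_∞), and A is this product
times a linear factor; in the second A = (aX)_∞(bX)_∞ = (1 - aX)(qaX)_∞(bX)_∞
(`exists_appellSeries_eq`).

From (ii) to (i): the Jackson integral between a and b with density (qx/a;q)_∞(qx/b;q)_∞ is a
positive discrete measure with σM_0 = d·M_0 (`exists_measure_moments`). Then (aX)_∞(bX)_∞M_j has
degree exactly j (`coeff_mul_momentSeries`), and the factor 1 - κX raises it to j + 1. -/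

open Filter Topology

noncomputable section

/-! ### q-exponential generating functions and the q-binomial theorem. -/

/-- The `q`-exponential generating function `∑ f n X ^ n / (q; q)_n`. -/
def qEgf (q : ℝ) (f : ℕ → ℝ) : PowerSeries ℝ := PowerSeries.mk fun n => f n / qPochhammer q q n

lemma qPochhammer_zero (a q : ℝ) : qPochhammer a q 0 = 1 := by simp [qPochhammer]

lemma qPochhammer_succ (a q : ℝ) (n : ℕ) :
    qPochhammer a q (n + 1) = qPochhammer a q n * (1 - a * q ^ n) :=
  Finset.prod_range_succ _ _

lemma one_sub_pow_pos {q : ℝ} (hq0 : 0 < q) (hq1 : q < 1) (n : ℕ) : 0 < 1 - q ^ (n + 1) :=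
  sub_pos.2 (pow_lt_one₀ hq0.le hq1 n.succ_ne_zero)

lemma qPochhammer_self_succ (q : ℝ) (n : ℕ) :
    qPochhammer q q (n + 1) = qPochhammer q q n * (1 - q ^ (n + 1)) := by
  rw [qPochhammer_succ, pow_succ']

lemma qPochhammer_self_pos {q : ℝ} (hq0 : 0 < q) (hq1 : q < 1) (n : ℕ) :
    0 < qPochhammer q q n := by
  induction n with
  | zero => simp [qPochhammer_zero]
  | succ n ih =>
    rw [qPochhammer_self_succ]
    exact mul_pos ih (one_sub_pow_pos hq0 hq1 n)

@[simp] lemma coeff_qEgf (q : ℝ) (f : ℕ → ℝ) (n : ℕ) :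
    PowerSeries.coeff n (qEgf q f) = f n / qPochhammer q q n := PowerSeries.coeff_mk _ _

lemma constantCoeff_rescale (q : ℝ) (F : PowerSeries ℝ) :
    PowerSeries.constantCoeff (PowerSeries.rescale q F) = PowerSeries.constantCoeff F := by
  rw [← PowerSeries.coeff_zero_eq_constantCoeff_apply, PowerSeries.coeff_rescale, pow_zero,
    one_mul, PowerSeries.coeff_zero_eq_constantCoeff_apply]

/-- Shifting the sequence amounts to a `q`-difference of the generating function. -/
lemma X_mul_qEgf_shift {q : ℝ} (hq0 : 0 < q) (hq1 : q < 1) (f : ℕ → ℝ) :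
    PowerSeries.X * qEgf q (fun n => f (n + 1)) =
      qEgf q f - PowerSeries.rescale q (qEgf q f) := by
  ext n
  cases n with
  | zero => simp [constantCoeff_rescale]
  | succ n =>
    have h1 := (qPochhammer_self_pos hq0 hq1 n).ne'
    have h2 := (one_sub_pow_pos hq0 hq1 n).ne'
    rw [PowerSeries.coeff_succ_X_mul, map_sub, PowerSeries.coeff_rescale, coeff_qEgf, coeff_qEgf,
      qPochhammer_self_succ]
    field_simp

/-- The `q`-exponential `∑ x ^ n X ^ n / (q; q)_n = 1 / (x X; q)_∞`. -/
def qExpSeries (q x : ℝ) : PowerSeries ℝ := qEgf q fun n => x ^ n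

/-- The series `∑ (-a) ^ n q ^ (n choose 2) X ^ n / (q; q)_n = (a X; q)_∞`. -/
def qPochhammerSeries (q a : ℝ) : PowerSeries ℝ := qEgf q fun n => (-a) ^ n * q ^ n.choose 2

lemma rescale_qExpSeries {q : ℝ} (hq0 : 0 < q) (hq1 : q < 1) (x : ℝ) :
    PowerSeries.rescale q (qExpSeries q x) =
      (1 - PowerSeries.C x * PowerSeries.X) * qExpSeries q x := by
  have h : qEgf q (fun n => x ^ (n + 1)) = PowerSeries.C x * qExpSeries q x := by
    ext n
    simp [qExpSeries, pow_succ']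
    ring
  have := X_mul_qEgf_shift hq0 hq1 fun n => x ^ n
  rw [h] at this
  change _ = qExpSeries q x - PowerSeries.rescale q (qExpSeries q x) at this
  linear_combination this

lemma qExpSeries_mul (q c x : ℝ) :
    qExpSeries q (c * x) = PowerSeries.rescale c (qExpSeries q x) := by
  ext n
  simp [qExpSeries, mul_pow, mul_div_assoc]

lemma qPochhammerSeries_eq {q : ℝ} (hq0 : 0 < q) (hq1 : q < 1) (a : ℝ) :
    qPochhammerSeries q a = (1 - PowerSeries.C a * PowerSeries.X) *
      PowerSeries.rescale q (qPochhammerSeries q a) := by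
  ext n
  cases n with
  | zero => simp [constantCoeff_rescale]
  | succ n =>
    have h1 := (qPochhammer_self_pos hq0 hq1 n).ne'
    have h2 := (one_sub_pow_pos hq0 hq1 n).ne'
    rw [sub_mul, one_mul, map_sub, mul_assoc, PowerSeries.coeff_C_mul,
      PowerSeries.coeff_succ_X_mul, PowerSeries.coeff_rescale, PowerSeries.coeff_rescale,
      qPochhammerSeries, coeff_qEgf, coeff_qEgf, qPochhammer_self_succ,
      Nat.choose_succ_succ, Nat.choose_one_right]
    field_simp
    ring

lemma constantCoeff_qEgf (q : ℝ) (f : ℕ → ℝ) :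
    PowerSeries.constantCoeff (qEgf q f) = f 0 := by
  rw [← PowerSeries.coeff_zero_eq_constantCoeff_apply, coeff_qEgf, qPochhammer_zero, div_one]

lemma constantCoeff_qExpSeries (q x : ℝ) :
    PowerSeries.constantCoeff (qExpSeries q x) = 1 := by simp [qExpSeries, constantCoeff_qEgf]

lemma constantCoeff_qPochhammerSeries (q x : ℝ) :
    PowerSeries.constantCoeff (qPochhammerSeries q x) = 1 := by
  simp [qPochhammerSeries, constantCoeff_qEgf]

/-- A power series invariant under `X ↦ q X` is constant. -/
lemma eq_C_of_rescale_eq {q : ℝ} (hq0 : 0 < q) (hq1 : q < 1) {F : PowerSeries ℝ}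
    (h : PowerSeries.rescale q F = F) : F = PowerSeries.C (PowerSeries.constantCoeff F) := by
  ext n
  cases n with
  | zero => simp
  | succ n =>
    have h1 := congrArg (PowerSeries.coeff (n + 1)) h
    rw [PowerSeries.coeff_rescale] at h1
    have h2 := (one_sub_pow_pos hq0 hq1 n).ne'
    rw [PowerSeries.coeff_C, if_neg n.succ_ne_zero]
    exact (mul_eq_zero.1 (by linear_combination -h1 :
      (1 - q ^ (n + 1)) * PowerSeries.coeff (n + 1) F = 0)).resolve_left h2

/-- The `q`-binomial theorem. -/
lemma coeff_qPochhammerSeries_mul_qExpSeries {q : ℝ} (hq0 : 0 < q) (hq1 : q < 1) (b x : ℝ)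
    (n : ℕ) :
    PowerSeries.coeff n (qPochhammerSeries q b * qExpSeries q x) =
      (∏ j ∈ Finset.range n, (x - b * q ^ j)) / qPochhammer q q n := by
  set F := qPochhammerSeries q b * qExpSeries q x with hF
  -- Comparing coefficients in this q-difference equation gives a one-step recursion, which the
  -- product on the right also satisfies.
  have hrec : (1 - PowerSeries.C b * PowerSeries.X) * PowerSeries.rescale q F =
      (1 - PowerSeries.C x * PowerSeries.X) * F := by
    rw [hF, map_mul, rescale_qExpSeries hq0 hq1]
    linear_combination (-(1 - PowerSeries.C x * PowerSeries.X) * qExpSeries q x) *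
      qPochhammerSeries_eq hq0 hq1 b
  induction n with
  | zero =>
    rw [PowerSeries.coeff_zero_eq_constantCoeff_apply, hF, map_mul,
      constantCoeff_qPochhammerSeries, constantCoeff_qExpSeries]
    simp [qPochhammer_zero]
  | succ n ih =>
    have h1 := (qPochhammer_self_pos hq0 hq1 n).ne'
    have h2 := (one_sub_pow_pos hq0 hq1 n).ne'
    have h := congrArg (PowerSeries.coeff (n + 1)) hrec
    simp only [sub_mul, one_mul, map_sub, mul_assoc, PowerSeries.coeff_C_mul,
      PowerSeries.coeff_succ_X_mul, PowerSeries.coeff_rescale] at h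
    rw [qPochhammer_self_succ, Finset.prod_range_succ, eq_div_iff (mul_ne_zero h1 h2)]
    rw [eq_div_iff h1] at ih
    linear_combination (-qPochhammer q q n) * h + (x - b * q ^ n) * ih

/-! ### Generating function of the Al-Salam–Carlitz polynomials. -/

lemma qPochhammer_inv_pow_eq_zero {q : ℝ} (hq0 : 0 < q) {n k : ℕ} (h : n < k) :
    qPochhammer (q ^ n)⁻¹ q k = 0 :=
  Finset.prod_eq_zero (Finset.mem_range.2 h) (by
    rw [inv_mul_cancel₀ (pow_pos hq0 n).ne', sub_self])

/-- With n = m + k, this trades (q^{-n};q)_k for (q;q)_n/(q;q)_m, so that term k of the ₂φ₁ shows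
coefficient n - k of (aX)_∞. The induction moves one unit from m to k, keeping n fixed. -/
lemma qPochhammer_inv_pow {q a : ℝ} (hq0 : 0 < q) (ha : a ≠ 0) (k m : ℕ) :
    (-a) ^ (m + k) * q ^ (m + k).choose 2 * qPochhammer (q ^ (m + k))⁻¹ q k * (q / a) ^ k *
        qPochhammer q q m =
      qPochhammer q q (m + k) * ((-a) ^ m * q ^ m.choose 2) := by
  induction k generalizing m with
  | zero => simp [qPochhammer_zero]; ring
  | succ k ih =>
    have h := ih (m + 1)
    have hq := (pow_pos hq0 m).ne'
    rw [show m + 1 + k = m + (k + 1) by ring, qPochhammer_self_succ, Nat.choose_succ_succ,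
      Nat.choose_one_right] at h
    rw [qPochhammer_succ, show (1 : ℝ) - (q ^ (m + (k + 1)))⁻¹ * q ^ k =
      -(1 - q ^ (m + 1)) / q ^ (m + 1) by field_simp; ring]
    have h2 : (-a) ^ (m + 1) * q ^ (m + m.choose 2) =
      (-a * q ^ m) * ((-a) ^ m * q ^ m.choose 2) := by ring
    rw [h2] at h
    apply mul_left_cancel₀ (mul_ne_zero (neg_ne_zero.2 ha) hq)
    rw [mul_left_comm (-a * q ^ m) (qPochhammer q q (m + (k + 1))), ← h, pow_succ (q / a),
      pow_succ q m]
    generalize qPochhammer (q ^ (m + (k + 1)))⁻¹ q k = P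
    generalize (q / a) ^ k = S
    field_simp

/-- The Al-Salam–Carlitz polynomials in terms of their generating function. -/
lemma alSalamCarlitzI_eq {q : ℝ} (hq0 : 0 < q) (hq1 : q < 1) {a b x : ℝ} (ha : a ≠ 0)
    (hb : b ≠ 0) (hx : x ≠ 0) (n : ℕ) :
    b ^ n * alSalamCarlitzI n (a / b) (x / b) q =
      qPochhammer q q n * PowerSeries.coeff n
        (qPochhammerSeries q a * qPochhammerSeries q b * qExpSeries q x) := by
  have hP := fun n => (qPochhammer_self_pos hq0 hq1 n).ne'
  unfold alSalamCarlitzI basicHypergeometric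
  rw [tsum_eq_sum (s := Finset.range (n + 1)) (fun k hk => by
    rw [Finset.mem_range, not_lt] at hk
    simp [qPochhammer_inv_pow_eq_zero hq0 (show n < k by omega)])]
  -- Term k of the ₂φ₁ is the Cauchy product term pairing coefficient n - k of (aX)_∞ with
  -- coefficient k of (bX)_∞/(xX)_∞; hence the reflected sum.
  rw [mul_assoc (qPochhammerSeries q a), PowerSeries.coeff_mul,
    Finset.Nat.sum_antidiagonal_eq_sum_range_succ_mk, Finset.mul_sum, Finset.mul_sum,
    Finset.mul_sum, ← Finset.sum_range_reflect]
  refine Finset.sum_congr rfl fun m hm => ?_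
  obtain ⟨k, rfl⟩ := Nat.exists_eq_add_of_le (Nat.lt_succ_iff.1 (Finset.mem_range.1 hm))
  rw [show m + k + 1 - 1 - m = k by omega, show m + k - m = k by omega,
    coeff_qPochhammerSeries_mul_qExpSeries hq0 hq1, qPochhammerSeries, coeff_qEgf]
  have h0 : qPochhammer 0 q k = 1 := by simp [qPochhammer]
  have hφ : qPochhammer (x / b)⁻¹ q k * x ^ k = ∏ j ∈ Finset.range k, (x - b * q ^ j) := by
    rw [qPochhammer, ← Finset.card_range k, ← Finset.prod_const, Finset.card_range,
      ← Finset.prod_mul_distrib]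
    refine Finset.prod_congr rfl fun j _ => ?_
    field_simp
  have h := qPochhammer_inv_pow hq0 ha k m
  simp only [List.map_cons, List.map_nil, List.prod_cons, List.prod_nil, h0, List.length_cons,
    List.length_nil, ← hφ]
  have hz : (1 : ℤ) + ((0 + 1 : ℕ) : ℤ) - ((0 + 1 + 1 : ℕ) : ℤ) = 0 := by norm_num
  rw [hz, zpow_zero, mul_one, mul_one, mul_one, div_one]
  have hb' : b ^ (m + k) * (-(a / b)) ^ (m + k) = (-a) ^ (m + k) := by
    rw [← mul_pow]; congr 1; field_simp
  have hz' : q * (x / b) / (a / b) = q / a * x := by field_simp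
  rw [hz', mul_pow]
  generalize qPochhammer (q ^ (m + k))⁻¹ q k = P at h ⊢
  generalize qPochhammer (x / b)⁻¹ q k = R
  generalize (q / a) ^ k = S at h ⊢
  generalize (-(a / b)) ^ (m + k) = T at hb' ⊢
  have hm := hP m
  have hk := hP k
  field_simp
  linear_combination R * h +
    (R * q ^ (m + k).choose 2 * P * S * qPochhammer q q m) * hb'

/-! ### Generating function of a q-Appell set. -/

/-- The generating function of the constant coefficients of a sequence of polynomials. -/
def appellSeries (q : ℝ) (Q : ℕ → Polynomial ℝ) : PowerSeries ℝ := qEgf q fun n => (Q n).coeff 0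

lemma IsQAppell.sub_comp {q : ℝ} (hq1 : q < 1) {Q : ℕ → Polynomial ℝ} (h : IsQAppell q Q)
    (n : ℕ) :
    Q n - (Q n).comp (Polynomial.C q * Polynomial.X) =
      Polynomial.C (1 - q ^ n) * (Polynomial.X * Q (n - 1)) := by
  refine Polynomial.funext fun x => ?_
  rcases eq_or_ne x 0 with rfl | hx
  · simp
  · have h1 := h.2 n x hx
    have h2 : 1 - q ≠ 0 := (sub_pos.2 hq1).ne'
    simp only [hahnDeriv, qNumber] at h1
    field_simp at h1
    simp only [Polynomial.eval_sub, Polynomial.eval_comp, Polynomial.eval_mul,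
      Polynomial.eval_C, Polynomial.eval_X]
    linear_combination h1

/-- The coefficients of a `q`-Appell set are determined by the constant coefficients. -/
lemma IsQAppell.coeff_mul {q : ℝ} (hq1 : q < 1) {Q : ℕ → Polynomial ℝ}
    (h : IsQAppell q Q) (i j : ℕ) :
    (Q (i + j)).coeff j * (qPochhammer q q i * qPochhammer q q j) =
      qPochhammer q q (i + j) * (Q i).coeff 0 := by
  induction j with
  | zero => rw [qPochhammer_zero]; simp [mul_comm]
  | succ j ih =>
    have h1 := congrArg (fun p => Polynomial.coeff p (j + 1)) (h.sub_comp hq1 (i + j + 1))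
    simp only [Polynomial.coeff_sub, Polynomial.comp_C_mul_X_coeff, Polynomial.coeff_C_mul,
      Polynomial.coeff_X_mul, Nat.add_sub_cancel] at h1
    rw [← add_assoc, qPochhammer_self_succ, qPochhammer_self_succ]
    linear_combination (1 - q ^ (i + j + 1)) * ih +
      qPochhammer q q i * qPochhammer q q j * h1

/-- The umbral form of the generating function: `f k` stands in for x^k. Powers of x give
evaluation; shifted moments give integrals. -/
lemma IsQAppell.sum_coeff_mul {q : ℝ} (hq0 : 0 < q) (hq1 : q < 1) {Q : ℕ → Polynomial ℝ}
    (h : IsQAppell q Q) (f : ℕ → ℝ) (n : ℕ) :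
    ∑ k ∈ Finset.range (n + 1), (Q n).coeff k * f k =
      qPochhammer q q n * PowerSeries.coeff n (appellSeries q Q * qEgf q f) := by
  rw [mul_comm (appellSeries q Q), PowerSeries.coeff_mul,
    Finset.Nat.sum_antidiagonal_eq_sum_range_succ_mk, Finset.mul_sum]
  refine Finset.sum_congr rfl fun k hk => ?_
  obtain ⟨i, rfl⟩ := Nat.exists_eq_add_of_le' (Nat.lt_succ_iff.1 (Finset.mem_range.1 hk))
  have h1 := h.coeff_mul hq1 i k
  have h2 := (qPochhammer_self_pos hq0 hq1 i).ne'
  have h3 := (qPochhammer_self_pos hq0 hq1 k).ne'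
  rw [appellSeries, coeff_qEgf, coeff_qEgf, Nat.add_sub_cancel]
  field_simp
  linear_combination f k * h1

lemma IsPolynomialSet.eval_eq {Q : ℕ → Polynomial ℝ} (h : IsPolynomialSet Q) (n : ℕ) (x : ℝ) :
    (Q n).eval x = ∑ k ∈ Finset.range (n + 1), (Q n).coeff k * x ^ k :=
  Polynomial.eval_eq_sum_range' (by
    rw [Polynomial.natDegree_eq_of_degree_eq_some (h n)]; exact n.lt_succ_self) x

lemma IsQAppell.eval_eq {q : ℝ} (hq0 : 0 < q) (hq1 : q < 1) {Q : ℕ → Polynomial ℝ}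
    (h : IsQAppell q Q) (n : ℕ) (x : ℝ) :
    (Q n).eval x =
      qPochhammer q q n * PowerSeries.coeff n (appellSeries q Q * qExpSeries q x) := by
  rw [h.1.eval_eq, h.sum_coeff_mul hq0 hq1]
  rfl

/-- A generating function characterizes `q`-Appell sets. -/
lemma isQAppell_of_eval_eq {q : ℝ} (hq0 : 0 < q) (hq1 : q < 1) {Q : ℕ → Polynomial ℝ}
    (hQ : IsPolynomialSet Q) (B : PowerSeries ℝ)
    (h : ∀ n x, x ≠ 0 → (Q n).eval x =
      qPochhammer q q n * PowerSeries.coeff n (B * qExpSeries q x)) :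
    IsQAppell q Q ∧ appellSeries q Q = B := by
  have hA : IsQAppell q Q := by
    refine ⟨hQ, fun n x hx => ?_⟩
    have h2 : 1 - q ≠ 0 := (sub_pos.2 hq1).ne'
    rw [hahnDeriv, qNumber, h n x hx, h n (q * x) (mul_ne_zero hq0.ne' hx), h (n - 1) x hx,
      qExpSeries_mul, rescale_qExpSeries hq0 hq1, ← mul_sub, ← map_sub,
      show B * qExpSeries q x - B * ((1 - PowerSeries.C x * PowerSeries.X) * qExpSeries q x) =
        PowerSeries.C x * (PowerSeries.X * (B * qExpSeries q x)) by ring,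
      PowerSeries.coeff_C_mul]
    cases n with
    | zero => simp
    | succ n =>
      rw [PowerSeries.coeff_succ_X_mul, qPochhammer_self_succ, Nat.add_sub_cancel]
      field_simp
  refine ⟨hA, ?_⟩
  -- One nonzero point suffices: the q-exponential has constant term 1 and can be cancelled.
  have h1 : appellSeries q Q * qExpSeries q 1 = B * qExpSeries q 1 := by
    ext n
    have := (hA.eval_eq hq0 hq1 n 1).symm.trans (h n 1 one_ne_zero)
    exact mul_left_cancel₀ (qPochhammer_self_pos hq0 hq1 n).ne' this
  refine mul_right_cancel₀ (fun h0 => ?_) h1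
  have := constantCoeff_qExpSeries q 1
  rw [h0] at this
  simp at this

/-! ### Condition (ii) as a factorization of the Appell series. -/

lemma IsPolynomialSet.zero_eq_one {Q : ℕ → Polynomial ℝ} (hQ : IsPolynomialSet Q)
    (hmonic : ∀ n, (Q n).Monic) : Q 0 = 1 := by
  refine (hmonic 0).natDegree_eq_zero.1 ?_
  exact Polynomial.natDegree_eq_of_degree_eq_some (hQ 0)

/-- The factor [n]_q turns (q;q)_{n-1} into (q;q)_n/(1 - q), so passing to index n - 1 is
multiplication by X/(1 - q). -/
lemma alSalamCarlitz_combination {q : ℝ} (hq0 : 0 < q) (hq1 : q < 1) {a b x lam : ℝ} (ha : a ≠ 0)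
    (hb : b ≠ 0) (hx : x ≠ 0) (n : ℕ) (hn : 1 ≤ n) :
    b ^ n * alSalamCarlitzI n (a / b) (x / b) q -
        b ^ n * qNumber q n / lam * alSalamCarlitzI (n - 1) (a / b) (x / b) q =
      qPochhammer q q n * PowerSeries.coeff n
        ((1 - PowerSeries.C (b / (lam * (1 - q))) * PowerSeries.X) *
          (qPochhammerSeries q a * qPochhammerSeries q b) * qExpSeries q x) := by
  obtain ⟨n, rfl⟩ := Nat.exists_eq_add_of_le' hn
  have h1 := alSalamCarlitzI_eq hq0 hq1 ha hb hx (n + 1)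
  have h2 := alSalamCarlitzI_eq hq0 hq1 ha hb hx n
  have h3 : 1 - q ≠ 0 := (sub_pos.2 hq1).ne'
  rw [mul_assoc, sub_mul, one_mul, map_sub, mul_assoc (PowerSeries.C _), PowerSeries.coeff_C_mul,
    PowerSeries.coeff_succ_X_mul, mul_sub, ← h1, qPochhammer_self_succ, Nat.add_sub_cancel,
    qNumber]
  rw [show qPochhammer q q n * (1 - q ^ (n + 1)) * (b / (lam * (1 - q)) *
    PowerSeries.coeff n (qPochhammerSeries q a * qPochhammerSeries q b * qExpSeries q x)) =
    (1 - q ^ (n + 1)) * (b / (lam * (1 - q))) * (qPochhammer q q n *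
    PowerSeries.coeff n (qPochhammerSeries q a * qPochhammerSeries q b * qExpSeries q x)) by ring,
    ← h2]
  have h4 : b ^ (n + 1) * ((1 - q ^ (n + 1)) / (1 - q)) / lam =
    (1 - q ^ (n + 1)) * (b / (lam * (1 - q))) * b ^ n := by
    rw [pow_succ, div_mul_eq_div_div]; ring
  rw [h4]
  ring

/-- Condition (ii) in terms of the generating function. -/
lemma exists_alSalamCarlitz_iff {q : ℝ} (hq0 : 0 < q) (hq1 : q < 1) {Q : ℕ → Polynomial ℝ}
    (hQ : IsPolynomialSet Q) (hmonic : ∀ n, (Q n).Monic) :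
    (∃ α β lam : ℝ, β ≠ 0 ∧ lam ≠ 0 ∧ α / β < 0 ∧
        ∀ n : ℕ, 1 ≤ n → ∀ x : ℝ, x ≠ 0 →
          (Q n).eval x =
            β ^ n * alSalamCarlitzI n (α / β) (x / β) q -
              β ^ n * qNumber q n / lam * alSalamCarlitzI (n - 1) (α / β) (x / β) q) ↔
      IsQAppell q Q ∧ ∃ a b κ : ℝ, a * b < 0 ∧ κ ≠ 0 ∧ appellSeries q Q =
        (1 - PowerSeries.C κ * PowerSeries.X) * (qPochhammerSeries q a * qPochhammerSeries q b) := by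
  have h3 : 1 - q ≠ 0 := (sub_pos.2 hq1).ne'
  constructor
  · rintro ⟨a, b, lam, hb, hlam, hab, h⟩
    have ha : a ≠ 0 := by rintro rfl; simp at hab
    have key := isQAppell_of_eval_eq hq0 hq1 hQ ((1 - PowerSeries.C (b / (lam * (1 - q))) *
      PowerSeries.X) * (qPochhammerSeries q a * qPochhammerSeries q b)) (by
        intro n x hx
        -- Condition (ii) is silent at n = 0; there monicity gives Q₀ = 1.
        rcases Nat.eq_zero_or_pos n with rfl | hn
        · rw [IsPolynomialSet.zero_eq_one hQ hmonic, PowerSeries.coeff_zero_eq_constantCoeff_apply]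
          simp [constantCoeff_qExpSeries, constantCoeff_qPochhammerSeries, qPochhammer_zero]
        · rw [h n hn x hx, alSalamCarlitz_combination hq0 hq1 ha hb hx n hn])
    refine ⟨key.1, a, b, _, ?_, ?_, key.2⟩
    · have := mul_neg_of_neg_of_pos hab (mul_self_pos.2 hb)
      rwa [show a / b * (b * b) = a * b by field_simp] at this
    · exact div_ne_zero hb (mul_ne_zero hlam h3)
  · rintro ⟨hA, a, b, κ, hab, hκ, h⟩
    have ha : a ≠ 0 := by rintro rfl; simp at hab
    have hb : b ≠ 0 := by rintro rfl; simp at hab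
    refine ⟨a, b, b / (κ * (1 - q)), hb, div_ne_zero hb (mul_ne_zero hκ h3), ?_, ?_⟩
    · have := mul_neg_of_neg_of_pos hab (inv_pos.2 (mul_self_pos.2 hb))
      rwa [show a * b * (b * b)⁻¹ = a / b by field_simp] at this
    · intro n hn x hx
      rw [alSalamCarlitz_combination hq0 hq1 ha hb hx n hn, hA.eval_eq hq0 hq1, h,
        show b / (b / (κ * (1 - q)) * (1 - q)) = κ by field_simp]

/-! ### Moments and quasi-orthogonality. -/

/-- The generating function of a moment sequence shifted by `j`. -/
def momentSeries (q : ℝ) (m : ℕ → ℝ) (j : ℕ) : PowerSeries ℝ := qEgf q fun k => m (k + j)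

lemma X_mul_momentSeries_succ {q : ℝ} (hq0 : 0 < q) (hq1 : q < 1) (m : ℕ → ℝ) (j : ℕ) :
    PowerSeries.X * momentSeries q m (j + 1) =
      momentSeries q m j - PowerSeries.rescale q (momentSeries q m j) := by
  rw [momentSeries, momentSeries, ← X_mul_qEgf_shift hq0 hq1]
  congr 3
  ext k
  congr 1
  ring

/-- Converts every integral condition on Q_n into a condition on one coefficient of A·M_j. -/
lemma integral_pow_mul_eval {μ : Measure ℝ} (hμ : ∀ k : ℕ, Integrable (fun x : ℝ => x ^ k) μ)
    {q : ℝ} (hq0 : 0 < q) (hq1 : q < 1) {Q : ℕ → Polynomial ℝ} (h : IsQAppell q Q) (n j : ℕ) :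
    ∫ x, x ^ j * (Q n).eval x ∂μ = qPochhammer q q n * PowerSeries.coeff n
      (appellSeries q Q * momentSeries q (fun k => ∫ x, x ^ k ∂μ) j) := by
  rw [momentSeries, ← h.sum_coeff_mul hq0 hq1]
  simp_rw [h.1.eval_eq, Finset.mul_sum]
  rw [integral_finsetSum]
  · refine Finset.sum_congr rfl fun k _ => ?_
    rw [← integral_const_mul]
    congr 1
    ext x
    ring
  · intro k _
    have := (hμ (k + j)).const_mul ((Q n).coeff k)
    refine this.congr (Filter.Eventually.of_forall fun x => ?_)
    simp only
    ring

/-! ### Quadratic q-difference equations. -/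

/-- The quadratic polynomial `1 - e₁ X + e₂ X²`. -/
def quad (e₁ e₂ : ℝ) : PowerSeries ℝ :=
  1 - PowerSeries.C e₁ * PowerSeries.X + PowerSeries.C e₂ * PowerSeries.X ^ 2

lemma quad_add_mul (a b : ℝ) : quad (a + b) (a * b) =
    (1 - PowerSeries.C a * PowerSeries.X) * (1 - PowerSeries.C b * PowerSeries.X) := by
  rw [quad, map_add, map_mul]; ring

/-- The product `(a X; q)_∞ (b X; q)_∞` solves a `q`-difference equation. -/
lemma qPochhammerSeries_mul_eq {q : ℝ} (hq0 : 0 < q) (hq1 : q < 1) (a b : ℝ) :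
    qPochhammerSeries q a * qPochhammerSeries q b = quad (a + b) (a * b) *
      PowerSeries.rescale q (qPochhammerSeries q a * qPochhammerSeries q b) := by
  rw [quad_add_mul, map_mul]
  conv_lhs => rw [qPochhammerSeries_eq hq0 hq1 a, qPochhammerSeries_eq hq0 hq1 b]
  ring

/-- If `F` and `G` satisfy reciprocal `q`-difference equations, then `F * G` is constant. -/
lemma mul_eq_C_of_rescale {q : ℝ} (hq0 : 0 < q) (hq1 : q < 1) {F G d : PowerSeries ℝ}
    (hF : F = d * PowerSeries.rescale q F) (hG : PowerSeries.rescale q G = d * G) :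
    F * G = PowerSeries.C (PowerSeries.constantCoeff F * PowerSeries.constantCoeff G) := by
  rw [← map_mul]
  refine eq_C_of_rescale_eq hq0 hq1 ?_
  rw [map_mul, hG]
  conv_rhs => rw [hF]
  ring

lemma exists_add_mul_of_neg {e₁ e₂ : ℝ} (h : e₂ < 0) :
    ∃ a b : ℝ, a + b = e₁ ∧ a * b = e₂ := by
  have h0 : 0 ≤ e₁ ^ 2 - 4 * e₂ := by nlinarith [sq_nonneg e₁]
  refine ⟨(e₁ + √(e₁ ^ 2 - 4 * e₂)) / 2, (e₁ - √(e₁ ^ 2 - 4 * e₂)) / 2, by ring, ?_⟩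
  linear_combination (-1 / 4) * Real.sq_sqrt h0

/-! ### The dichotomy for quasi-orthogonal q-Appell sets. -/

lemma exists_polynomial_coe {F : PowerSeries ℝ} (N : ℕ)
    (h : ∀ n, N < n → PowerSeries.coeff n F = 0) :
    ∃ p : Polynomial ℝ, p.natDegree ≤ N ∧ (p : PowerSeries ℝ) = F := by
  refine ⟨PowerSeries.trunc (N + 1) F, ?_, ?_⟩
  · exact Nat.lt_succ_iff.1 (PowerSeries.natDegree_trunc_lt F N)
  · ext n
    rw [Polynomial.coeff_coe, PowerSeries.coeff_trunc]
    split_ifs with hn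
    · rfl
    · exact (h n (by omega)).symm

lemma rescale_coe (q : ℝ) (p : Polynomial ℝ) : PowerSeries.rescale q (p : PowerSeries ℝ) =
    (p.comp (Polynomial.C q * Polynomial.X) : Polynomial ℝ) := by
  ext n
  rw [PowerSeries.coeff_rescale, Polynomial.coeff_coe, Polynomial.coeff_coe,
    Polynomial.comp_C_mul_X_coeff, mul_comm]

/-- The linear polynomial l(cX) divides s because s vanishes at its zero; the quotient has degree at
most 2, and constant term 1 since s(0) = l(0). It is needed for c = q and c = 1. -/
lemma exists_quad_of_mul {l s : Polynomial ℝ} (hl : l.natDegree ≤ 1) (hl1 : l.coeff 1 ≠ 0)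
    (hl0 : l.coeff 0 ≠ 0) (hs : s.natDegree ≤ 3) (h0 : s.coeff 0 = l.coeff 0) {c : ℝ}
    (hc : c ≠ 0) (hroot : s.eval (-l.coeff 0 / (c * l.coeff 1)) = 0) :
    ∃ e₁ e₂ : ℝ, (s : PowerSeries ℝ) = quad e₁ e₂ * PowerSeries.rescale c (l : PowerSeries ℝ) := by
  set τ := -l.coeff 0 / (c * l.coeff 1) with hτ
  obtain ⟨p, hp⟩ := Polynomial.dvd_iff_isRoot.2 hroot
  have hlx : l = Polynomial.C (l.coeff 1) * Polynomial.X + Polynomial.C (l.coeff 0) :=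
    Polynomial.eq_X_add_C_of_natDegree_le_one hl
  have hlc : l.comp (Polynomial.C c * Polynomial.X) =
      Polynomial.C (c * l.coeff 1) * (Polynomial.X - Polynomial.C τ) := by
    conv_lhs => rw [hlx]
    simp only [Polynomial.add_comp, Polynomial.mul_comp, Polynomial.C_comp, Polynomial.X_comp]
    rw [mul_sub, ← Polynomial.C_mul (a := c * l.coeff 1) (b := τ),
      show c * l.coeff 1 * τ = -l.coeff 0 by rw [hτ]; field_simp]
    simp only [map_mul, map_neg]
    ring
  have hdeg : p.natDegree ≤ 2 := by
    rcases eq_or_ne p 0 with rfl | hp0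
    · simp
    · have := congrArg Polynomial.natDegree hp
      rw [Polynomial.natDegree_mul (Polynomial.X_sub_C_ne_zero τ) hp0,
        Polynomial.natDegree_X_sub_C] at this
      omega
  set k := (c * l.coeff 1)⁻¹ with hk
  have hk' : k * (c * l.coeff 1) = 1 := inv_mul_cancel₀ (mul_ne_zero hc hl1)
  have hpk : k * p.coeff 0 = 1 := by
    have := congrArg (fun r => Polynomial.coeff r 0) hp
    simp only [Polynomial.mul_coeff_zero, Polynomial.coeff_sub, Polynomial.coeff_X_zero,
      Polynomial.coeff_C_zero, h0] at this
    have h2 : (c * l.coeff 1) * τ = -l.coeff 0 := by rw [hτ]; field_simp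
    refine mul_left_cancel₀ hl0 ?_
    linear_combination (-k * p.coeff 0) * h2 - this + (τ * p.coeff 0) * hk'
  refine ⟨-(k * p.coeff 1), k * p.coeff 2, ?_⟩
  have hs' : s = (1 - Polynomial.C (-(k * p.coeff 1)) * Polynomial.X +
      Polynomial.C (k * p.coeff 2) * Polynomial.X ^ 2) * l.comp (Polynomial.C c * Polynomial.X) := by
    have hpx : p = Polynomial.C (p.coeff 0) + Polynomial.C (p.coeff 1) * Polynomial.X +
        Polynomial.C (p.coeff 2) * Polynomial.X ^ 2 := by
      conv_lhs => rw [p.as_sum_range_C_mul_X_pow' (n := 3) (by omega)]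
      simp [Finset.sum_range_succ]
    have hq : Polynomial.C k * p = 1 - Polynomial.C (-(k * p.coeff 1)) * Polynomial.X +
      Polynomial.C (k * p.coeff 2) * Polynomial.X ^ 2 := by
      conv_lhs => rw [hpx]
      rw [← Polynomial.C_1, ← hpk]
      simp only [map_mul, map_neg]
      ring
    rw [← hq, hlc, hp]
    have h1 : Polynomial.C k * Polynomial.C (c * l.coeff 1) = 1 := by
      rw [← Polynomial.C_mul, hk', Polynomial.C_1]
    linear_combination (-(Polynomial.X - Polynomial.C τ) * p) * h1
  rw [rescale_coe, hs']
  simp [quad]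

/-- The two possible shapes of the generating function of a quasi-orthogonal `q`-Appell set. -/
lemma quad_dichotomy {q : ℝ} (hq0 : 0 < q) (hq1 : q < 1) {A : PowerSeries ℝ} {m : ℕ → ℝ}
    (hA : PowerSeries.constantCoeff A = 1) (hm : m 0 ≠ 0)
    (h : ∀ n j, j + 2 ≤ n → PowerSeries.coeff n (A * momentSeries q m j) = 0)
    (h1 : PowerSeries.coeff 1 (A * momentSeries q m 0) ≠ 0) :
    ∃ e₁ e₂ : ℝ, PowerSeries.rescale q (momentSeries q m 0) = quad e₁ e₂ * momentSeries q m 0 ∨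
      A = quad e₁ e₂ * PowerSeries.rescale q A := by
  obtain ⟨l, hld, hl⟩ := exists_polynomial_coe 1 fun n hn => h n 0 hn
  obtain ⟨r, hrd, hr⟩ := exists_polynomial_coe 2 fun n hn => h n 1 hn
  obtain ⟨t, -, ht⟩ := exists_polynomial_coe 3 fun n hn => h n 2 hn
  have hA0 : A ≠ 0 := by rintro rfl; simp at hA
  have hM1 := X_mul_momentSeries_succ hq0 hq1 m 0
  have hM2 := X_mul_momentSeries_succ hq0 hq1 m 1
  set M := momentSeries q m 0
  set M1 := momentSeries q m (0 + 1)
  set M2 := momentSeries q m (1 + 1)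
  have hσM1 := congrArg (PowerSeries.rescale q) hM1
  rw [map_mul, map_sub, PowerSeries.rescale_X] at hσM1
  set σA := PowerSeries.rescale q A
  -- These are A·σM and A·σ²M: `s` uses σM = M - X·M1, and `y` uses σ²M = qX²·M2 - qM + (1 + q)σM.
  set s : Polynomial ℝ := l - Polynomial.X * r with hs
  set y : Polynomial ℝ := Polynomial.C q * Polynomial.X ^ 2 * t - Polynomial.C q * l +
    Polynomial.C (1 + q) * s with hy
  have hs' : (s : PowerSeries ℝ) = A * PowerSeries.rescale q M := by
    rw [hs, Polynomial.coe_sub, Polynomial.coe_mul, Polynomial.coe_X, hl, hr]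
    linear_combination (-A) * hM1
  have hy' : (y : PowerSeries ℝ) = A * PowerSeries.rescale q (PowerSeries.rescale q M) := by
    rw [hy, Polynomial.coe_add, Polynomial.coe_sub, Polynomial.coe_mul, Polynomial.coe_mul,
      Polynomial.coe_mul, Polynomial.coe_mul, Polynomial.coe_pow, Polynomial.coe_X,
      Polynomial.coe_C, Polynomial.coe_C, hl, ht, hs', map_add, map_one]
    linear_combination (PowerSeries.C q * PowerSeries.X * A) * hM2 +
      (PowerSeries.C q * A) * hM1 - A * hσM1
  have hσ : ∀ F G : PowerSeries ℝ, PowerSeries.rescale q (F * G) =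
    PowerSeries.rescale q F * PowerSeries.rescale q G := fun F G => map_mul _ F G
  have hsA : (s : PowerSeries ℝ) * σA = PowerSeries.rescale q (l : PowerSeries ℝ) * A := by
    rw [hs', hl, hσ]; ring
  -- Both sides equal A·σA·σM·σ²M.
  have hid : s * s.comp (Polynomial.C q * Polynomial.X) =
      y * l.comp (Polynomial.C q * Polynomial.X) := by
    apply Polynomial.coe_injective
    rw [Polynomial.coe_mul, Polynomial.coe_mul, ← rescale_coe, ← rescale_coe, hy', hl]
    rw [hs', hσ, hσ]
    ring
  have hl1 : l.coeff 1 ≠ 0 := by rwa [← Polynomial.coeff_coe, hl]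
  have hl0 : l.coeff 0 ≠ 0 := by
    rw [← Polynomial.coeff_coe, hl, PowerSeries.coeff_zero_eq_constantCoeff_apply, map_mul, hA,
      one_mul]
    rwa [show PowerSeries.constantCoeff M = m 0 from constantCoeff_qEgf _ _]
  have hs0 : s.coeff 0 = l.coeff 0 := by simp [hs]
  have hsd : s.natDegree ≤ 3 := by
    refine (Polynomial.natDegree_sub_le _ _).trans (max_le (by omega) ?_)
    exact Polynomial.natDegree_mul_le.trans (by rw [Polynomial.natDegree_X]; omega)
  have hlτ : (l.comp (Polynomial.C q * Polynomial.X)).eval (-l.coeff 0 / (q * l.coeff 1)) = 0 := by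
    rw [Polynomial.eq_X_add_C_of_natDegree_le_one hld]
    simp
    field_simp
    ring
  -- At the zero τ of σl either s(τ) = 0, so that σl divides s, or s(qτ) = 0, where qτ is the zero
  -- of l itself.
  have hprod := congrArg (Polynomial.eval (-l.coeff 0 / (q * l.coeff 1))) hid
  rw [Polynomial.eval_mul, Polynomial.eval_mul, hlτ, mul_zero, mul_eq_zero] at hprod
  rcases hprod with hB | hA'
  · obtain ⟨e₁, e₂, he⟩ := exists_quad_of_mul hld hl1 hl0 hsd hs0 hq0.ne' hB
    refine ⟨e₁, e₂, Or.inr ?_⟩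
    rw [he] at hsA
    have hne : PowerSeries.rescale q (l : PowerSeries ℝ) ≠ 0 := by
      intro h0
      have := congrArg PowerSeries.constantCoeff h0
      rw [constantCoeff_rescale, ← PowerSeries.coeff_zero_eq_constantCoeff_apply,
        Polynomial.coeff_coe] at this
      exact hl0 (by simpa using this)
    refine mul_left_cancel₀ hne ?_
    linear_combination -hsA
  · have hA'' : s.eval (-l.coeff 0 / (1 * l.coeff 1)) = 0 := by
      rw [Polynomial.eval_comp] at hA'
      rw [← hA']
      congr 1
      simp
      field_simp
    obtain ⟨e₁, e₂, he⟩ := exists_quad_of_mul hld hl1 hl0 hsd hs0 one_ne_zero hA''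
    refine ⟨e₁, e₂, Or.inl ?_⟩
    rw [PowerSeries.rescale_one, RingHom.id_apply, hl, hs'] at he
    refine mul_left_cancel₀ hA0 ?_
    linear_combination he

/-! ### Moment recursions, positivity and low-order coefficients. -/

lemma coeff_quad_mul_zero (e₁ e₂ : ℝ) (F : PowerSeries ℝ) :
    PowerSeries.coeff 0 (quad e₁ e₂ * F) = PowerSeries.coeff 0 F := by
  simp [quad]

lemma coeff_quad_mul_one (e₁ e₂ : ℝ) (F : PowerSeries ℝ) :
    PowerSeries.coeff 1 (quad e₁ e₂ * F) =
      PowerSeries.coeff 1 F - e₁ * PowerSeries.coeff 0 F := by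
  rw [quad, add_mul, sub_mul, one_mul, mul_assoc, mul_assoc, pow_two, mul_assoc, map_add, map_sub,
    PowerSeries.coeff_C_mul, PowerSeries.coeff_C_mul, PowerSeries.coeff_succ_X_mul,
    PowerSeries.coeff_succ_X_mul, PowerSeries.coeff_zero_X_mul, mul_zero, add_zero]

lemma coeff_quad_mul_add_two (e₁ e₂ : ℝ) (F : PowerSeries ℝ) (n : ℕ) :
    PowerSeries.coeff (n + 2) (quad e₁ e₂ * F) = PowerSeries.coeff (n + 2) F -
      e₁ * PowerSeries.coeff (n + 1) F + e₂ * PowerSeries.coeff n F := by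
  rw [quad, add_mul, sub_mul, one_mul, mul_assoc, mul_assoc, pow_two, mul_assoc, map_add, map_sub,
    PowerSeries.coeff_C_mul, PowerSeries.coeff_C_mul, PowerSeries.coeff_succ_X_mul,
    PowerSeries.coeff_succ_X_mul, PowerSeries.coeff_succ_X_mul]

/-- The moment recursion equivalent to a `q`-difference equation. -/
lemma rescale_qEgf_eq_quad_mul_iff {q : ℝ} (hq0 : 0 < q) (hq1 : q < 1) (e₁ e₂ : ℝ) (m : ℕ → ℝ) :
    PowerSeries.rescale q (qEgf q m) = quad e₁ e₂ * qEgf q m ↔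
      m 1 = e₁ * m 0 ∧ ∀ n, m (n + 2) = e₁ * m (n + 1) - e₂ * (1 - q ^ (n + 1)) * m n := by
  have h1 : (PowerSeries.coeff 1 (PowerSeries.rescale q (qEgf q m)) =
      PowerSeries.coeff 1 (quad e₁ e₂ * qEgf q m)) ↔ m 1 = e₁ * m 0 := by
    have h := (one_sub_pow_pos hq0 hq1 0).ne'
    simp only [coeff_quad_mul_one, PowerSeries.coeff_rescale, coeff_qEgf,
      qPochhammer_self_succ q 0, qPochhammer_zero, zero_add, pow_one, one_mul, div_one] at h ⊢
    rw [← sub_eq_zero, ← sub_eq_zero (a := m 1)]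
    rw [show q * (m 1 / (1 - q)) - (m 1 / (1 - q) - e₁ * m 0) = -(m 1 - e₁ * m 0) by
      field_simp; ring, neg_eq_zero]
  have h2 : ∀ n, (PowerSeries.coeff (n + 2) (PowerSeries.rescale q (qEgf q m)) =
      PowerSeries.coeff (n + 2) (quad e₁ e₂ * qEgf q m)) ↔
        m (n + 2) = e₁ * m (n + 1) - e₂ * (1 - q ^ (n + 1)) * m n := by
    intro n
    have ha := (one_sub_pow_pos hq0 hq1 n).ne'
    have hb := (one_sub_pow_pos hq0 hq1 (n + 1)).ne'
    have hc := (qPochhammer_self_pos hq0 hq1 n).ne'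
    simp only [coeff_quad_mul_add_two, PowerSeries.coeff_rescale, coeff_qEgf,
      qPochhammer_self_succ q (n + 1), qPochhammer_self_succ q n] at hb ⊢
    rw [← sub_eq_zero, ← sub_eq_zero (a := m (n + 2))]
    rw [show q ^ (n + 2) * (m (n + 2) / (qPochhammer q q n * (1 - q ^ (n + 1)) *
        (1 - q ^ (n + 1 + 1)))) - (m (n + 2) / (qPochhammer q q n * (1 - q ^ (n + 1)) *
        (1 - q ^ (n + 1 + 1))) - e₁ * (m (n + 1) / (qPochhammer q q n * (1 - q ^ (n + 1)))) +
        e₂ * (m n / qPochhammer q q n)) =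
      -(m (n + 2) - (e₁ * m (n + 1) - e₂ * (1 - q ^ (n + 1)) * m n)) /
        (qPochhammer q q n * (1 - q ^ (n + 1))) by field_simp; ring]
    simp only [div_eq_zero_iff, mul_eq_zero, ha, hc, or_false, neg_eq_zero]
  rw [PowerSeries.ext_iff, ← h1]
  constructor
  · exact fun h => ⟨h 1, fun n => (h2 n).1 (h (n + 2))⟩
  · rintro ⟨h, h'⟩ n
    match n with
    | 0 => rw [coeff_quad_mul_zero, PowerSeries.coeff_rescale, pow_zero, one_mul]
    | 1 => exact h
    | n + 2 => exact (h2 n).2 (h' n)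

lemma integrable_polynomial_eval {μ : Measure ℝ}
    (hμ : ∀ k : ℕ, Integrable (fun x : ℝ => x ^ k) μ) (p : Polynomial ℝ) {f : ℝ → ℝ}
    (hf : ∀ x, p.eval x = f x) : Integrable f μ := by
  obtain rfl : (fun x => p.eval x) = f := funext hf
  simp_rw [Polynomial.eval_eq_sum_range]
  exact integrable_finsetSum _ fun k _ => (hμ k).const_mul _

lemma integral_add_mul_add_mul {μ : Measure ℝ} {f g h : ℝ → ℝ} (hf : Integrable f μ)
    (hg : Integrable g μ) (hh : Integrable h μ) (a b : ℝ) :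
    ∫ x, f x + a * g x + b * h x ∂μ = ∫ x, f x ∂μ + a * ∫ x, g x ∂μ + b * ∫ x, h x ∂μ := by
  have h1 := integral_add (hf.add (hg.const_mul a)) (hh.const_mul b)
  have h2 := integral_add hf (hg.const_mul a)
  simp only [Pi.add_apply] at h1
  rw [h1, h2, integral_const_mul, integral_const_mul]

/-- A polynomial whose square integrates to zero is orthogonal to every polynomial. -/
lemma integral_mul_eval_eq_zero {μ : Measure ℝ}
    (hμ : ∀ k : ℕ, Integrable (fun x : ℝ => x ^ k) μ) {p : Polynomial ℝ}
    (h : ∫ x, p.eval x ^ 2 ∂μ = 0) (f : ℝ → ℝ) : ∫ x, f x * p.eval x ∂μ = 0 := by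
  have hi : Integrable (fun x => p.eval x ^ 2) μ :=
    integrable_polynomial_eval hμ (p ^ 2) fun x => by simp
  have h0 := (integral_eq_zero_iff_of_nonneg (fun x => sq_nonneg _) hi).1 h
  refine integral_eq_zero_of_ae (h0.mono fun x hx => ?_)
  have : p.eval x = 0 := by simpa using hx
  simp [this]

lemma coeff_two_mul_qEgf {q : ℝ} (hq0 : 0 < q) (hq1 : q < 1) (a f : ℕ → ℝ) :
    qPochhammer q q 2 * PowerSeries.coeff 2 (qEgf q a * qEgf q f) =
      a 0 * f 2 + (1 + q) * (a 1 * f 1) + a 2 * f 0 := by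
  have h1 := (one_sub_pow_pos hq0 hq1 0).ne'
  have h2 := (one_sub_pow_pos hq0 hq1 1).ne'
  rw [PowerSeries.coeff_mul, Finset.Nat.sum_antidiagonal_eq_sum_range_succ_mk]
  simp only [Finset.sum_range_succ, Finset.sum_range_zero, coeff_qEgf, qPochhammer_self_succ q 1,
    qPochhammer_self_succ q 0, qPochhammer_zero, Nat.sub_self, Nat.reduceSub, Nat.sub_zero,
    Nat.reduceAdd, zero_add, one_mul, pow_one, div_one] at h1 h2 ⊢
  field_simp
  ring

lemma coeff_three_mul_qEgf {q : ℝ} (hq0 : 0 < q) (hq1 : q < 1) (a f : ℕ → ℝ) :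
    qPochhammer q q 3 * PowerSeries.coeff 3 (qEgf q a * qEgf q f) =
      a 0 * f 3 + (1 + q + q ^ 2) * (a 1 * f 2 + a 2 * f 1) + a 3 * f 0 := by
  have h1 := (one_sub_pow_pos hq0 hq1 0).ne'
  have h2 := (one_sub_pow_pos hq0 hq1 1).ne'
  have h3 := (one_sub_pow_pos hq0 hq1 2).ne'
  rw [PowerSeries.coeff_mul, Finset.Nat.sum_antidiagonal_eq_sum_range_succ_mk]
  simp only [Finset.sum_range_succ, Finset.sum_range_zero, coeff_qEgf, qPochhammer_self_succ q 2,
    qPochhammer_self_succ q 1, qPochhammer_self_succ q 0, qPochhammer_zero, Nat.sub_self,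
    Nat.reduceSub, Nat.sub_zero, Nat.reduceAdd, zero_add, one_mul, pow_one, div_one] at h1 h2 h3 ⊢
  field_simp
  ring

/-- The first coefficients of a solution of `F = (1 - e₁ X + e₂ X²) F(q X)`. -/
lemma coeffs_of_eq_quad_mul_rescale {q : ℝ} (hq0 : 0 < q) (hq1 : q < 1) {e₁ e₂ : ℝ} {a : ℕ → ℝ}
    (h0 : a 0 = 1) (h : qEgf q a = quad e₁ e₂ * PowerSeries.rescale q (qEgf q a)) :
    a 1 = -e₁ ∧ a 2 = -e₁ * q * a 1 + e₂ * (1 - q) ∧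
      a 3 = -e₁ * q ^ 2 * a 2 + e₂ * q * (1 - q ^ 2) * a 1 := by
  have h1 := (one_sub_pow_pos hq0 hq1 0).ne'
  have h2 := (one_sub_pow_pos hq0 hq1 1).ne'
  have h3 := (one_sub_pow_pos hq0 hq1 2).ne'
  have c1 := congrArg (PowerSeries.coeff 1) h
  have c2 := congrArg (PowerSeries.coeff (0 + 2)) h
  have c3 := congrArg (PowerSeries.coeff (1 + 2)) h
  simp only [coeff_quad_mul_one, coeff_quad_mul_add_two, PowerSeries.coeff_rescale, coeff_qEgf,
    qPochhammer_self_succ q 2, qPochhammer_self_succ q 1, qPochhammer_self_succ q 0,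
    qPochhammer_zero, Nat.reduceAdd, zero_add, one_mul, pow_one, pow_zero, div_one, h0]
    at h1 h2 h3 c1 c2 c3
  field_simp at c1 c2 c3
  refine ⟨?_, ?_, ?_⟩
  · apply mul_left_cancel₀ h1
    linear_combination c1
  · apply mul_left_cancel₀ h2
    linear_combination c2
  · apply mul_left_cancel₀ h3
    linear_combination c3

lemma qPochhammerSeries_mul (q c a : ℝ) :
    qPochhammerSeries q (c * a) = PowerSeries.rescale c (qPochhammerSeries q a) := by
  ext n
  rw [PowerSeries.coeff_rescale, qPochhammerSeries, qPochhammerSeries, coeff_qEgf, coeff_qEgf,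
    ← mul_neg, mul_pow]
  ring

/-- The quotient F/G is fixed by σ, hence constant. -/
lemma eq_of_eq_mul_rescale {q : ℝ} (hq0 : 0 < q) (hq1 : q < 1) {F G d : PowerSeries ℝ}
    (hF : F = d * PowerSeries.rescale q F) (hG : G = d * PowerSeries.rescale q G)
    (hF0 : PowerSeries.constantCoeff F = 1) (hG0 : PowerSeries.constantCoeff G = 1) : F = G := by
  have hinv : G * G⁻¹ = 1 := PowerSeries.mul_inv_cancel G (by rw [hG0]; exact one_ne_zero)
  have hσ : PowerSeries.rescale q G * PowerSeries.rescale q G⁻¹ = 1 := by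
    rw [← map_mul, hinv, map_one]
  have hG' : PowerSeries.rescale q G⁻¹ = d * G⁻¹ := by
    linear_combination (-PowerSeries.rescale q G⁻¹) * hinv + d * G⁻¹ * hσ +
      G⁻¹ * PowerSeries.rescale q G⁻¹ * hG
  have h := mul_eq_C_of_rescale hq0 hq1 hF hG'
  rw [PowerSeries.constantCoeff_inv, hF0, hG0, inv_one, mul_one, map_one] at h
  linear_combination G * h - F * hinv

/-! ### From quasi-orthogonality to the factorization. -/

/-- A quasi-orthogonal `q`-Appell set is a combination of two consecutive Al-Salam–Carlitz
polynomials. -/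
lemma exists_appellSeries_eq {q : ℝ} (hq0 : 0 < q) (hq1 : q < 1) {Q : ℕ → Polynomial ℝ}
    (hmonic : ∀ n, (Q n).Monic) (hQ : IsQAppell q Q) {μ : Measure ℝ}
    (hμ : ∀ k : ℕ, Integrable (fun x : ℝ => x ^ k) μ)
    (hzero : ∀ n m : ℕ, m + 2 ≤ n → ∫ x, x ^ m * (Q n).eval x ∂μ = 0)
    (hne : ∀ n m : ℕ, m + 1 = n → ∫ x, x ^ m * (Q n).eval x ∂μ ≠ 0)
    (hne0 : ∫ x, (Q 0).eval x ∂μ ≠ 0) :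
    ∃ a b κ : ℝ, a * b < 0 ∧ κ ≠ 0 ∧ appellSeries q Q =
      (1 - PowerSeries.C κ * PowerSeries.X) * (qPochhammerSeries q a * qPochhammerSeries q b) := by
  have hQ0 : Q 0 = 1 := hQ.1.zero_eq_one hmonic
  set m : ℕ → ℝ := fun k => ∫ x, x ^ k ∂μ with hm
  have hP := fun n => (qPochhammer_self_pos hq0 hq1 n).ne'
  have hint := integral_pow_mul_eval hμ hq0 hq1 hQ
  have hA0 : PowerSeries.constantCoeff (appellSeries q Q) = 1 := by
    rw [appellSeries, constantCoeff_qEgf, hQ0, Polynomial.coeff_one_zero]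
  have hm0 : m 0 ≠ 0 := by simpa [hm, hQ0] using hne0
  have hm0' : 0 < m 0 :=
    lt_of_le_of_ne (integral_nonneg fun x => by simp) hm0.symm
  have hvan : ∀ n j, j + 2 ≤ n →
      PowerSeries.coeff n (appellSeries q Q * momentSeries q m j) = 0 := by
    intro n j hj
    have := hzero n j hj
    rw [hint] at this
    exact (mul_eq_zero.1 this).resolve_left (hP n)
  have h1 : PowerSeries.coeff 1 (appellSeries q Q * momentSeries q m 0) ≠ 0 := by
    have := hne 1 0 rfl
    rw [hint] at this
    exact right_ne_zero_of_mul this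
  have hsq : ∀ c : ℝ, ∫ x, (Polynomial.X - Polynomial.C c).eval x ^ 2 ∂μ =
      m 2 - 2 * c * m 1 + c ^ 2 * m 0 := by
    intro c
    have : ∀ x : ℝ, (Polynomial.X - Polynomial.C c).eval x ^ 2 =
        x ^ 2 + -(2 * c) * x ^ 1 + c ^ 2 * x ^ 0 := fun x => by simp; ring
    simp_rw [this]
    rw [integral_add_mul_add_mul (hμ 2) (hμ 1) (hμ 0)]
    simp only [hm]
    ring
  obtain ⟨e₁, e₂, hA | hB⟩ := quad_dichotomy hq0 hq1 hA0 hm0 hvan h1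
  · obtain ⟨hr1, hr2⟩ := (rescale_qEgf_eq_quad_mul_iff hq0 hq1 e₁ e₂ m).1 hA
    have he2 : e₂ < 0 := by
      have hs := hsq e₁
      have hr := hr2 0
      have hpos : 0 ≤ ∫ x, (Polynomial.X - Polynomial.C e₁).eval x ^ 2 ∂μ :=
        integral_nonneg fun x => sq_nonneg _
      -- Otherwise x = e₁ almost everywhere, and ∫ x Q₂ = e₁ ∫ Q₂ = 0 contradicts the nonvanishing
      -- condition.
      have hne' : ∫ x, (Polynomial.X - Polynomial.C e₁).eval x ^ 2 ∂μ ≠ 0 := by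
        intro h0
        have h2 := integral_mul_eval_eq_zero hμ h0 fun x => (Q 2).eval x
        refine hne 2 1 rfl ?_
        have h3 := hzero 2 0 le_rfl
        have h4 : ∀ x : ℝ, x ^ 1 * (Q 2).eval x =
            (Q 2).eval x * (Polynomial.X - Polynomial.C e₁).eval x +
              e₁ * (x ^ 0 * (Q 2).eval x) := fun x => by simp; ring
        simp_rw [h4]
        rw [integral_add, integral_const_mul, h2, h3, mul_zero, add_zero]
        · exact integrable_polynomial_eval hμ (Q 2 * (Polynomial.X - Polynomial.C e₁))
            fun x => by rw [Polynomial.eval_mul]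
        · exact integrable_polynomial_eval hμ (Polynomial.C e₁ * Q 2) fun x => by simp
      have hlt := lt_of_le_of_ne hpos hne'.symm
      rw [hs] at hlt
      simp only [zero_add, pow_one] at hr
      have hq := one_sub_pow_pos hq0 hq1 0
      rw [zero_add, pow_one] at hq
      -- The recursion evaluates ∫ (x - e₁)² as -e₂(1 - q)m₀, which fixes the sign of e₂.
      have h5 : m 2 - 2 * e₁ * m 1 + e₁ ^ 2 * m 0 = -e₂ * ((1 - q) * m 0) := by
        linear_combination hr - e₁ * hr1
      rw [h5] at hlt
      have := (pos_iff_pos_of_mul_pos hlt).2 (mul_pos hq hm0')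
      linarith
    obtain ⟨a, b, rfl, rfl⟩ := exists_add_mul_of_neg (e₁ := e₁) he2
    set E := qPochhammerSeries q a * qPochhammerSeries q b
    have hEM : E * momentSeries q m 0 = PowerSeries.C (m 0) := by
      rw [mul_eq_C_of_rescale hq0 hq1 (qPochhammerSeries_mul_eq hq0 hq1 a b) hA,
        map_mul PowerSeries.constantCoeff, constantCoeff_qPochhammerSeries,
        constantCoeff_qPochhammerSeries, momentSeries,
        constantCoeff_qEgf]
      simp
    set c := PowerSeries.coeff 1 (appellSeries q Q * momentSeries q m 0) with hc
    have hl : appellSeries q Q * momentSeries q m 0 =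
        PowerSeries.C (m 0) + PowerSeries.C c * PowerSeries.X := by
      ext n
      match n with
      | 0 =>
        rw [PowerSeries.coeff_zero_eq_constantCoeff_apply, map_mul, hA0, momentSeries,
          constantCoeff_qEgf]
        simp
      | 1 => simp [← hc, PowerSeries.coeff_C]
      | n + 2 =>
        rw [hvan (n + 2) 0 (by omega)]
        simp
    -- From A·M = m₀ + cX and E·M = m₀ one gets A = (1 + (c/m₀)X)·E.
    refine ⟨a, b, -c / m 0, he2, div_ne_zero (neg_ne_zero.2 h1) hm0, ?_⟩
    have hC : PowerSeries.C (m 0) ≠ (0 : PowerSeries ℝ) := by simpa using hm0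
    have hc' : PowerSeries.C (m 0) * PowerSeries.C (-c / m 0) = (-PowerSeries.C c : PowerSeries ℝ) := by
      rw [← map_mul, mul_div_cancel₀ _ hm0, map_neg]
    refine mul_left_cancel₀ hC ?_
    linear_combination E * hl - appellSeries q Q * hEM + PowerSeries.X * E * hc'
  · have ha0 : (Q 0).coeff 0 = 1 := by rw [hQ0, Polynomial.coeff_one_zero]
    obtain ⟨p1, p2, p3⟩ := coeffs_of_eq_quad_mul_rescale (a := fun n => (Q n).coeff 0)
      hq0 hq1 ha0 hB
    have he2 : e₂ < 0 := by
      -- Here the equation for A determines Q₂ and Q₃ up to e₁, e₂; their vanishing integrals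
      -- express m₂, m₃, m₄ through m₀, m₁, and then ∫ Q₂² > 0 fails if e₂ ≥ 0.
      by_contra! hnn
      have i20 := hzero 2 0 le_rfl
      have i30 := hzero 3 0 (by norm_num)
      have i31 := hzero 3 1 le_rfl
      have i21 := hint 2 1
      have i22 := hint 2 2
      rw [hint] at i20 i30 i31
      rw [appellSeries, momentSeries, coeff_two_mul_qEgf hq0 hq1] at i20 i21 i22
      rw [appellSeries, momentSeries, coeff_three_mul_qEgf hq0 hq1] at i30 i31
      have hev : ∀ x : ℝ, (Q 2).eval x =
          x ^ 2 + (1 + q) * (Q 1).coeff 0 * x + (Q 2).coeff 0 := by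
        intro x
        rw [hQ.eval_eq hq0 hq1, appellSeries, qExpSeries, coeff_two_mul_qEgf hq0 hq1, ha0]
        ring
      have hH2 : ∫ x, (Q 2).eval x ^ 2 ∂μ = ∫ x, x ^ 2 * (Q 2).eval x ∂μ +
          (1 + q) * (Q 1).coeff 0 * ∫ x, x ^ 1 * (Q 2).eval x ∂μ +
          (Q 2).coeff 0 * ∫ x, x ^ 0 * (Q 2).eval x ∂μ := by
        have hi : ∀ k : ℕ, Integrable (fun x => x ^ k * (Q 2).eval x) μ := fun k =>
          integrable_polynomial_eval hμ (Polynomial.X ^ k * Q 2) fun x => by simp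
        rw [← integral_add_mul_add_mul (hi 2) (hi 1) (hi 0)]
        congr 1
        ext x
        have := hev x
        linear_combination (Q 2).eval x * this
      have hpos : 0 < ∫ x, (Q 2).eval x ^ 2 ∂μ := by
        refine lt_of_le_of_ne (integral_nonneg fun x => sq_nonneg _) fun h0 => ?_
        exact hne 2 1 rfl (integral_mul_eval_eq_zero hμ h0.symm fun x => x ^ 1)
      have hH1 : 0 ≤ m 2 - 2 * e₁ * m 1 + e₁ ^ 2 * m 0 := by
        rw [← hsq]
        exact integral_nonneg fun x => sq_nonneg _
      rw [hH2, i22, i21, hzero 2 0 le_rfl] at hpos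
      have hs : ∀ k, ∫ x, x ^ k ∂μ = m k := fun k => rfl
      simp only [ha0, p3, p2, p1, hs, Nat.reduceAdd, zero_add, one_mul, mul_zero, add_zero]
        at i20 i30 i31 hpos
      have hg1 : 0 ≤ 1 - q := by linarith
      have hg2 : 0 ≤ 1 - q ^ 2 := (one_sub_pow_pos hq0 hq1 1).le
      -- After substituting the moments, ∫ Q₂² is exactly minus the sum of the two quantities in
      -- `hk1` and `hk2`.
      have hk1 : 0 ≤ e₂ * q * (1 - q ^ 2) * (m 2 - 2 * e₁ * m 1 + e₁ ^ 2 * m 0) := by positivity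
      have hk2 : 0 ≤ q * (e₂ * q * (1 - q ^ 2)) *
        (m 2 - 2 * e₁ * m 1 + e₁ ^ 2 * m 0 + e₂ * (1 - q) * m 0) := by positivity
      have m2 : m 2 = (1 + q) * e₁ * m 1 - (-e₁ * q * -e₁ + e₂ * (1 - q)) * m 0 := by
        linear_combination i20
      have m3 : m 3 = (1 + q + q ^ 2) * (e₁ * m 2 - (-e₁ * q * -e₁ + e₂ * (1 - q)) * m 1) -
          (-e₁ * q ^ 2 * (-e₁ * q * -e₁ + e₂ * (1 - q)) + e₂ * q * (1 - q ^ 2) * -e₁) * m 0 := by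
        linear_combination i30
      have m4 : m 4 = (1 + q + q ^ 2) * (e₁ * m 3 - (-e₁ * q * -e₁ + e₂ * (1 - q)) * m 2) -
          (-e₁ * q ^ 2 * (-e₁ * q * -e₁ + e₂ * (1 - q)) + e₂ * q * (1 - q ^ 2) * -e₁) * m 1 := by
        linear_combination i31
      rw [m4, m3, m2] at hpos
      rw [m2] at hk1 hk2
      linarith
    obtain ⟨a, b, rfl, rfl⟩ := exists_add_mul_of_neg (e₁ := e₁) he2
    have ha : a ≠ 0 := by rintro rfl; simp at he2
    -- Peeling the first factor off (aX)_∞ = (1 - aX)(qaX)_∞ supplies the linear factor, so κ = a.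
    refine ⟨q * a, b, a, ?_, ha, ?_⟩
    · rw [mul_assoc]
      exact mul_neg_of_pos_of_neg hq0 he2
    · have hE := eq_of_eq_mul_rescale hq0 hq1 hB (qPochhammerSeries_mul_eq hq0 hq1 a b) hA0 (by
        rw [map_mul, constantCoeff_qPochhammerSeries, constantCoeff_qPochhammerSeries, one_mul])
      rw [hE, qPochhammerSeries_mul]
      conv_lhs => rw [qPochhammerSeries_eq hq0 hq1 a]
      ring

/-! ### The infinite product (y;q)_∞. -/

/-- The infinite product `(y; q)_∞`, as a function of `y`. -/
def qPochhammerInf (q y : ℝ) : ℝ := ∏' j : ℕ, (1 - y * q ^ j)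

lemma summable_neg_mul_pow {q : ℝ} (hq0 : 0 < q) (hq1 : q < 1) (y : ℝ) :
    Summable fun j : ℕ => -(y * q ^ j) :=
  ((summable_geometric_of_lt_one hq0.le hq1).mul_left y).neg

lemma multipliable_one_sub_mul_pow {q : ℝ} (hq0 : 0 < q) (hq1 : q < 1) (y : ℝ) :
    Multipliable fun j : ℕ => 1 - y * q ^ j := by
  simpa only [sub_eq_add_neg] using
    Real.multipliable_one_add_of_summable (summable_neg_mul_pow hq0 hq1 y)

lemma qPochhammerInf_eq {q : ℝ} (hq0 : 0 < q) (hq1 : q < 1) (y : ℝ) :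
    qPochhammerInf q y = (1 - y) * qPochhammerInf q (q * y) := by
  have h : ∀ j : ℕ, 1 - y * q ^ (j + 1) = 1 - q * y * q ^ j := fun j => by ring
  rw [qPochhammerInf, tprod_eq_zero_mul', qPochhammerInf]
  · simp [h]
  · simp_rw [h]
    exact multipliable_one_sub_mul_pow hq0 hq1 _

lemma one_sub_mul_pow_pos {q : ℝ} (hq0 : 0 < q) (hq1 : q < 1) {y : ℝ} (hy : y < 1) (j : ℕ) :
    0 < 1 - y * q ^ j := by
  have h1 := pow_pos hq0 j
  have h2 := pow_le_one₀ hq0.le hq1.le (n := j)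
  nlinarith

lemma qPochhammerInf_pos {q : ℝ} (hq0 : 0 < q) (hq1 : q < 1) {y : ℝ} (hy : y < 1) :
    0 < qPochhammerInf q y := by
  have hlog : Summable fun j : ℕ => Real.log (1 - y * q ^ j) := by
    simpa only [sub_eq_add_neg] using
      Real.summable_log_one_add_of_summable (summable_neg_mul_pow hq0 hq1 y)
  rw [qPochhammerInf, ← Real.rexp_tsum_eq_tprod (one_sub_mul_pow_pos hq0 hq1 hy) hlog]
  exact Real.exp_pos _

lemma qPochhammerInf_one {q : ℝ} (hq0 : 0 < q) (hq1 : q < 1) : qPochhammerInf q 1 = 0 := by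
  rw [qPochhammerInf_eq hq0 hq1, sub_self, zero_mul]

lemma prod_mul_qPochhammerInf {q : ℝ} (hq0 : 0 < q) (hq1 : q < 1) (y : ℝ) (k : ℕ) :
    (∏ j ∈ Finset.range k, (1 - y * q ^ j)) * qPochhammerInf q (y * q ^ k) =
      qPochhammerInf q y := by
  induction k with
  | zero => simp
  | succ k ih =>
    rw [← ih, Finset.prod_range_succ, qPochhammerInf_eq hq0 hq1 (y * q ^ k)]
    ring_nf

lemma tendsto_qPochhammerInf_of_lt {q : ℝ} (hq0 : 0 < q) (hq1 : q < 1) {y : ℝ} (hy : y < 1) :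
    Tendsto (fun k : ℕ => qPochhammerInf q (y * q ^ k)) atTop (𝓝 1) := by
  have hE := (qPochhammerInf_pos hq0 hq1 hy).ne'
  have h := (multipliable_one_sub_mul_pow hq0 hq1 y).tendsto_prod_tprod_nat
  have h2 := (tendsto_const_nhds (x := qPochhammerInf q y)).div h hE
  rw [← qPochhammerInf, div_self hE] at h2
  refine h2.congr fun k => ?_
  rw [Pi.div_apply, ← prod_mul_qPochhammerInf hq0 hq1 y k, mul_div_cancel_left₀]
  exact (Finset.prod_pos fun j _ => one_sub_mul_pow_pos hq0 hq1 hy j).ne'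

/-- At y = 1 the product is 0 and cannot be divided by; dropping the first term of the sequence
reduces to yq < 1. -/
lemma tendsto_qPochhammerInf {q : ℝ} (hq0 : 0 < q) (hq1 : q < 1) {y : ℝ} (hy : y ≤ 1) :
    Tendsto (fun k : ℕ => qPochhammerInf q (y * q ^ k)) atTop (𝓝 1) := by
  have h := tendsto_qPochhammerInf_of_lt hq0 hq1 (y := y * q) (by nlinarith)
  refine (tendsto_add_atTop_iff_nat 1).1 (h.congr fun k => ?_)
  rw [pow_succ']; ring_nf

lemma hasSum_sub_succ {g : ℕ → ℝ} {l : ℝ} (hs : Summable fun k => g k - g (k + 1))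
    (hg : Tendsto g atTop (𝓝 l)) : HasSum (fun k => g k - g (k + 1)) (g 0 - l) := by
  rw [hs.hasSum_iff_tendsto_nat]
  simp_rw [Finset.sum_range_sub']
  exact tendsto_const_nhds.sub hg

/-! ### The Al-Salam–Carlitz functional as a positive measure. -/

/-- The weight function of the Al-Salam–Carlitz functional. -/
def ascWeight (q a b x : ℝ) : ℝ := qPochhammerInf q (x / a) * qPochhammerInf q (x / b)

/-- The moments of the Al-Salam–Carlitz functional on the branch `b q ^ k`: a Jackson integral
from `0` to `b`. -/
def ascMoment (q a b : ℝ) (n : ℕ) : ℝ :=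
  ∑' k : ℕ, b * q ^ k * ascWeight q a b (b * q ^ (k + 1)) * (b * q ^ k) ^ n

lemma div_neg_of_mul_neg {a b : ℝ} (hab : a * b < 0) : b / a < 0 := by
  have ha : a ≠ 0 := by rintro rfl; simp at hab
  have := mul_neg_of_neg_of_pos hab (inv_pos.2 (mul_self_pos.2 ha))
  rwa [show a * b * (a * a)⁻¹ = b / a by field_simp] at this

lemma ascWeight_pos {q : ℝ} (hq0 : 0 < q) (hq1 : q < 1) {a b : ℝ} (hab : a * b < 0) (k : ℕ) :
    0 < ascWeight q a b (b * q ^ (k + 1)) := by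
  have hb : b ≠ 0 := by rintro rfl; simp at hab
  have h1 := pow_pos hq0 (k + 1)
  refine mul_pos (qPochhammerInf_pos hq0 hq1 ?_) (qPochhammerInf_pos hq0 hq1 ?_)
  · rw [mul_div_right_comm]
    exact (mul_neg_of_neg_of_pos (div_neg_of_mul_neg hab) h1).trans one_pos
  · rw [mul_div_cancel_left₀ _ hb]
    exact pow_lt_one₀ hq0.le hq1 k.succ_ne_zero

/-- The q-Pearson equation of the weight; it makes the moment sums telescope. -/
lemma ascWeight_succ {q : ℝ} (hq0 : 0 < q) (hq1 : q < 1) (a b : ℝ) (k : ℕ) :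
    ascWeight q a b (b * q ^ k) = (1 - b * q ^ k / a) * (1 - b * q ^ k / b) *
      ascWeight q a b (b * q ^ (k + 1)) := by
  rw [ascWeight, qPochhammerInf_eq hq0 hq1, qPochhammerInf_eq hq0 hq1 (b * q ^ k / b), ascWeight,
    show q * (b * q ^ k / a) = b * q ^ (k + 1) / a by ring,
    show q * (b * q ^ k / b) = b * q ^ (k + 1) / b by ring]
  ring

lemma ascWeight_zero {q : ℝ} (hq0 : 0 < q) (hq1 : q < 1) {a b : ℝ} (hb : b ≠ 0) :
    ascWeight q a b (b * q ^ 0) = 0 := by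
  rw [ascWeight, pow_zero, mul_one, div_self hb, qPochhammerInf_one hq0 hq1, mul_zero]

lemma tendsto_ascWeight {q : ℝ} (hq0 : 0 < q) (hq1 : q < 1) {a b : ℝ} (hab : a * b < 0) :
    Tendsto (fun k : ℕ => ascWeight q a b (b * q ^ k)) atTop (𝓝 1) := by
  have hb : b ≠ 0 := by rintro rfl; simp at hab
  have h := (tendsto_qPochhammerInf hq0 hq1
    ((div_neg_of_mul_neg hab).le.trans zero_le_one)).mul (tendsto_qPochhammerInf hq0 hq1 le_rfl)
  rw [mul_one] at h
  refine h.congr fun k => ?_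
  rw [ascWeight, mul_div_right_comm, mul_div_right_comm, div_self hb]

lemma summable_ascMoment {q : ℝ} (hq0 : 0 < q) (hq1 : q < 1) {a b : ℝ} (hab : a * b < 0)
    (n : ℕ) :
    Summable fun k : ℕ => b * q ^ k * ascWeight q a b (b * q ^ (k + 1)) * (b * q ^ k) ^ n := by
  obtain ⟨B, hB⟩ := (tendsto_ascWeight hq0 hq1 hab).bddAbove_range
  have hg := (summable_geometric_of_lt_one hq0.le hq1).mul_left (|b| ^ (n + 1) * B)
  refine Summable.of_norm_bounded hg fun k => ?_
  have h1 := ascWeight_pos hq0 hq1 hab k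
  have h2 : ascWeight q a b (b * q ^ (k + 1)) ≤ B := hB ⟨k + 1, rfl⟩
  have h3 := pow_pos hq0 k
  have h4 : (q ^ k) ^ n ≤ 1 := pow_le_one₀ h3.le (pow_le_one₀ hq0.le hq1.le)
  rw [Real.norm_eq_abs, abs_mul, abs_mul, abs_pow, abs_mul, abs_of_pos h1, abs_of_pos h3]
  calc |b| * q ^ k * ascWeight q a b (b * q ^ (k + 1)) * (|b| * q ^ k) ^ n
      = |b| ^ (n + 1) * q ^ k * (ascWeight q a b (b * q ^ (k + 1)) * (q ^ k) ^ n) := by ring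
    _ ≤ |b| ^ (n + 1) * q ^ k * (B * 1) := by gcongr; exact h1.le.trans h2
    _ = |b| ^ (n + 1) * B * q ^ k := by ring

/-- Telescoping w(bq^k): the weight vanishes at b and tends to 1 at 0. The resulting term -ab is
symmetric in a and b, so it cancels between the two branches. -/
lemma ascMoment_one {q : ℝ} (hq0 : 0 < q) (hq1 : q < 1) {a b : ℝ} (hab : a * b < 0) :
    ascMoment q a b 1 = (a + b) * ascMoment q a b 0 - a * b := by
  have ha : a ≠ 0 := by rintro rfl; simp at hab
  have hb : b ≠ 0 := by rintro rfl; simp at hab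
  have s0 := (summable_ascMoment hq0 hq1 hab 0).hasSum
  have s1 := (summable_ascMoment hq0 hq1 hab 1).hasSum
  have hs := (s0.mul_left (-(a⁻¹ + b⁻¹))).add (s1.mul_left (a * b)⁻¹)
  have heq : ∀ k : ℕ, -(a⁻¹ + b⁻¹) *
      (b * q ^ k * ascWeight q a b (b * q ^ (k + 1)) * (b * q ^ k) ^ 0) +
      (a * b)⁻¹ * (b * q ^ k * ascWeight q a b (b * q ^ (k + 1)) * (b * q ^ k) ^ 1) =
      ascWeight q a b (b * q ^ k) - ascWeight q a b (b * q ^ (k + 1)) := by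
    intro k
    rw [ascWeight_succ hq0 hq1 a b k]
    field_simp
    ring
  simp_rw [heq] at hs
  have h := hs.unique (hasSum_sub_succ hs.summable (tendsto_ascWeight hq0 hq1 hab))
  rw [ascWeight_zero hq0 hq1 hb] at h
  change -(a⁻¹ + b⁻¹) * ascMoment q a b 0 + (a * b)⁻¹ * ascMoment q a b 1 = 0 - 1 at h
  field_simp at h
  linear_combination h

/-- Telescoping x^{n+1}w(x) along x = bq^k: now both boundary terms vanish. -/
lemma ascMoment_add_two {q : ℝ} (hq0 : 0 < q) (hq1 : q < 1) {a b : ℝ} (hab : a * b < 0)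
    (n : ℕ) :
    ascMoment q a b (n + 2) = (a + b) * ascMoment q a b (n + 1) -
      a * b * (1 - q ^ (n + 1)) * ascMoment q a b n := by
  have ha : a ≠ 0 := by rintro rfl; simp at hab
  have hb : b ≠ 0 := by rintro rfl; simp at hab
  have s0 := (summable_ascMoment hq0 hq1 hab n).hasSum
  have s1 := (summable_ascMoment hq0 hq1 hab (n + 1)).hasSum
  have s2 := (summable_ascMoment hq0 hq1 hab (n + 2)).hasSum
  have hs := ((s0.mul_left (1 - q ^ (n + 1))).add (s1.mul_left (-(a⁻¹ + b⁻¹)))).add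
    (s2.mul_left (a * b)⁻¹)
  have heq : ∀ k : ℕ, (1 - q ^ (n + 1)) *
      (b * q ^ k * ascWeight q a b (b * q ^ (k + 1)) * (b * q ^ k) ^ n) + -(a⁻¹ + b⁻¹) *
      (b * q ^ k * ascWeight q a b (b * q ^ (k + 1)) * (b * q ^ k) ^ (n + 1)) +
      (a * b)⁻¹ * (b * q ^ k * ascWeight q a b (b * q ^ (k + 1)) * (b * q ^ k) ^ (n + 2)) =
      (b * q ^ k) ^ (n + 1) * ascWeight q a b (b * q ^ k) -
        (b * q ^ (k + 1)) ^ (n + 1) * ascWeight q a b (b * q ^ (k + 1)) := by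
    intro k
    rw [ascWeight_succ hq0 hq1 a b k, show b * q ^ (k + 1) = b * q ^ k * q by ring,
      mul_pow _ q (n + 1)]
    generalize ascWeight q a b (b * q ^ k * q) = g
    generalize q ^ k = t
    field_simp
    ring
  simp_rw [heq] at hs
  have hlim : Tendsto (fun k : ℕ => (b * q ^ k) ^ (n + 1) * ascWeight q a b (b * q ^ k)) atTop
      (𝓝 0) := by
    have h0 := (((tendsto_pow_atTop_nhds_zero_of_lt_one hq0.le hq1).const_mul b).pow (n + 1)).mul
      (tendsto_ascWeight hq0 hq1 hab)
    simpa using h0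
  have h := hs.unique (hasSum_sub_succ hs.summable hlim)
  rw [ascWeight_zero hq0 hq1 hb] at h
  change (1 - q ^ (n + 1)) * ascMoment q a b n + -(a⁻¹ + b⁻¹) * ascMoment q a b (n + 1) +
    (a * b)⁻¹ * ascMoment q a b (n + 2) = _ at h
  rw [mul_zero, sub_zero] at h
  field_simp at h
  linear_combination h

/-- The positive discrete measure with the moments of one branch. -/
lemma exists_measure_ascMoment {q : ℝ} (hq0 : 0 < q) (hq1 : q < 1) {a b ε : ℝ} (hab : a * b < 0)
    (hε : 0 < ε * b) :
    ∃ μ : Measure ℝ, (∀ n : ℕ, Integrable (fun x : ℝ => x ^ n) μ) ∧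
      (∀ n : ℕ, ∫ x, x ^ n ∂μ = ε * ascMoment q a b n) ∧ 0 < ε * ascMoment q a b 0 := by
  set c : ℕ → ℝ := fun k => ε * (b * q ^ k * ascWeight q a b (b * q ^ (k + 1))) with hc
  have hcpos : ∀ k, 0 < c k := fun k => by
    have h1 := ascWeight_pos hq0 hq1 hab k
    have h2 := pow_pos hq0 k
    have : c k = ε * b * (q ^ k * ascWeight q a b (b * q ^ (k + 1))) := by simp only [hc]; ring
    rw [this]
    positivity
  have hsum : ∀ n, Summable fun k => c k * (b * q ^ k) ^ n := fun n => by
    simpa only [hc, mul_assoc] using (summable_ascMoment hq0 hq1 hab n).mul_left ε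
  have htsum : ∀ n, ∑' k, c k * (b * q ^ k) ^ n = ε * ascMoment q a b n := fun n => by
    rw [ascMoment, ← tsum_mul_left]
    exact tsum_congr fun k => by simp only [hc]; ring
  have htop : ∀ k, ENNReal.ofReal (c k) ≠ ⊤ := fun k => ENNReal.ofReal_ne_top
  refine ⟨Measure.sum fun k => ENNReal.ofReal (c k) • Measure.dirac (b * q ^ k), fun n => ?_,
    fun n => ?_, ?_⟩
  · refine integrable_sum_dirac htop ?_
    refine (hsum n).abs.congr fun k => ?_
    rw [ENNReal.toReal_ofReal (hcpos k).le, abs_mul, abs_of_pos (hcpos k), Real.norm_eq_abs]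
  · rw [integral_sum_dirac htop, ← htsum]
    exact tsum_congr fun k => by rw [ENNReal.toReal_ofReal (hcpos k).le, smul_eq_mul]
  · rw [← htsum]
    exact (hsum 0).tsum_pos (fun k => by simpa using (hcpos k).le) 0 (by simpa using hcpos 0)

/-- The Jackson integral from a to b is the b-branch minus the a-branch. Multiplying by b makes both
contributions positive, since b² > 0 and -ba > 0. -/
lemma exists_measure_moments {q : ℝ} (hq0 : 0 < q) (hq1 : q < 1) {a b : ℝ} (hab : a * b < 0) :
    ∃ μ : Measure ℝ, (∀ n : ℕ, Integrable (fun x : ℝ => x ^ n) μ) ∧ 0 < ∫ x, x ^ 0 ∂μ ∧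
      ∫ x, x ^ 1 ∂μ = (a + b) * ∫ x, x ^ 0 ∂μ ∧
      ∀ n : ℕ, ∫ x, x ^ (n + 2) ∂μ = (a + b) * ∫ x, x ^ (n + 1) ∂μ -
        a * b * (1 - q ^ (n + 1)) * ∫ x, x ^ n ∂μ := by
  have hba : b * a < 0 := by rwa [mul_comm]
  have hb : b ≠ 0 := by rintro rfl; simp at hab
  obtain ⟨μ, h1, h2, h3⟩ := exists_measure_ascMoment hq0 hq1 (ε := b) hab (mul_self_pos.2 hb)
  obtain ⟨ν, h1', h2', h3'⟩ := exists_measure_ascMoment hq0 hq1 (ε := -b) hba (by linarith)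
  have hadd : ∀ n : ℕ, ∫ x, x ^ n ∂(μ + ν) = b * ascMoment q a b n + -b * ascMoment q b a n :=
    fun n => by rw [integral_add_measure (h1 n) (h1' n), h2, h2']
  refine ⟨μ + ν, fun n => (h1 n).add_measure (h1' n), ?_, ?_, fun n => ?_⟩
  · rw [hadd]
    exact add_pos h3 h3'
  · rw [hadd, hadd, ascMoment_one hq0 hq1 hab, ascMoment_one hq0 hq1 hba]
    ring
  · rw [hadd, hadd, hadd, ascMoment_add_two hq0 hq1 hab, ascMoment_add_two hq0 hq1 hba]
    ring

/-- Every finite nonzero measure on the line is, up to normalization, a Lebesgue–Stieltjes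
measure of a monotone function. -/
lemma exists_monotone_stieltjes_eq (μ : Measure ℝ) [IsFiniteMeasure μ] (hμ : μ ≠ 0) :
    ∃ (w : ℝ → ℝ) (hw : Monotone w), hw.stieltjesFunction.measure = (μ Set.univ)⁻¹ • μ := by
  have : NeZero μ := ⟨hμ⟩
  set ν := (μ Set.univ)⁻¹ • μ
  have : IsProbabilityMeasure ν := inferInstance
  refine ⟨ProbabilityTheory.cdf ν, ProbabilityTheory.monotone_cdf ν, ?_⟩
  conv_rhs => rw [← ProbabilityTheory.measure_cdf ν]
  congr 1
  ext x
  rw [Monotone.stieltjesFunction_eq]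
  exact StieltjesFunction.rightLim_eq _ x

/-! ### From the factorization to quasi-orthogonality. -/

/-- Orthogonality of the Al-Salam–Carlitz polynomials, in terms of generating functions. -/
lemma coeff_mul_momentSeries {q : ℝ} (hq0 : 0 < q) (hq1 : q < 1) {a b : ℝ} (hab : a * b ≠ 0)
    {m : ℕ → ℝ} (hm0 : m 0 ≠ 0)
    (hm : PowerSeries.rescale q (momentSeries q m 0) =
      quad (a + b) (a * b) * momentSeries q m 0) (j : ℕ) :
    (∀ n, j < n → PowerSeries.coeff n
      (qPochhammerSeries q a * qPochhammerSeries q b * momentSeries q m j) = 0) ∧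
    PowerSeries.coeff j
      (qPochhammerSeries q a * qPochhammerSeries q b * momentSeries q m j) ≠ 0 := by
  have hE := qPochhammerSeries_mul_eq hq0 hq1 a b
  have hE0 : PowerSeries.constantCoeff (qPochhammerSeries q a * qPochhammerSeries q b) = 1 := by
    rw [map_mul, constantCoeff_qPochhammerSeries, constantCoeff_qPochhammerSeries, one_mul]
  set E := qPochhammerSeries q a * qPochhammerSeries q b
  induction j with
  | zero =>
    have h : E * momentSeries q m 0 = PowerSeries.C (m 0) := by
      rw [mul_eq_C_of_rescale hq0 hq1 hE hm, hE0, momentSeries, constantCoeff_qEgf, one_mul]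
    rw [h]
    exact ⟨fun n hn => PowerSeries.coeff_C_of_ne_zero hn.ne', by rwa [PowerSeries.coeff_zero_C]⟩
  | succ j ih =>
    have hrec : PowerSeries.X * (E * momentSeries q m (j + 1)) = E * momentSeries q m j -
        quad (a + b) (a * b) * PowerSeries.rescale q (E * momentSeries q m j) := by
      rw [map_mul]
      linear_combination E * X_mul_momentSeries_succ hq0 hq1 m j -
        PowerSeries.rescale q (momentSeries q m j) * hE
    have hcoeff : ∀ n, PowerSeries.coeff (n + 1) (E * momentSeries q m (j + 1)) =
        PowerSeries.coeff (n + 2) (E * momentSeries q m j) -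
        (q ^ (n + 2) * PowerSeries.coeff (n + 2) (E * momentSeries q m j) -
          (a + b) * (q ^ (n + 1) * PowerSeries.coeff (n + 1) (E * momentSeries q m j)) +
          a * b * (q ^ n * PowerSeries.coeff n (E * momentSeries q m j))) := by
      intro n
      rw [← PowerSeries.coeff_succ_X_mul, hrec, map_sub, coeff_quad_mul_add_two,
        PowerSeries.coeff_rescale, PowerSeries.coeff_rescale, PowerSeries.coeff_rescale]
    refine ⟨fun n hn => ?_, ?_⟩
    · obtain ⟨n, rfl⟩ := Nat.exists_eq_add_of_le' (Nat.one_le_of_lt hn)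
      rw [hcoeff, ih.1 (n + 2) (by omega), ih.1 (n + 1) (by omega), ih.1 n (by omega)]
      ring
    -- The top coefficient is multiplied by -ab·q^j at each step.
    · rw [hcoeff, ih.1 (j + 2) (by omega), ih.1 (j + 1) (by omega)]
      have := mul_ne_zero hab (mul_ne_zero (pow_pos hq0 j).ne' ih.2)
      simpa using this

lemma isQuasiOrthogonal_of_appellSeries_eq {q : ℝ} (hq0 : 0 < q) (hq1 : q < 1)
    {Q : ℕ → Polynomial ℝ} (hmonic : ∀ n, (Q n).Monic) (hQ : IsQAppell q Q) {a b κ : ℝ}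
    (hab : a * b < 0) (hκ : κ ≠ 0) (hA : appellSeries q Q =
      (1 - PowerSeries.C κ * PowerSeries.X) * (qPochhammerSeries q a * qPochhammerSeries q b)) :
    IsQuasiOrthogonal Q := by
  obtain ⟨μ, hint, hpos, hone, hrec⟩ := exists_measure_moments hq0 hq1 hab
  have hfin : IsFiniteMeasure μ := by
    have h := hint 0
    simp only [pow_zero] at h
    exact (integrable_const_iff_isFiniteMeasure one_ne_zero).1 h
  have hμ0 : μ ≠ 0 := by rintro rfl; simp at hpos
  obtain ⟨w, hw, hwμ⟩ := exists_monotone_stieltjes_eq μ hμ0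
  have hμuniv : μ Set.univ ≠ 0 := by simpa using hμ0
  have hint' : ∀ k : ℕ, Integrable (fun x : ℝ => x ^ k) hw.stieltjesFunction.measure := by
    intro k
    rw [hwμ]
    exact (hint k).smul_measure (ENNReal.inv_ne_top.2 hμuniv)
  have hmom : ∀ k : ℕ, ∫ x, x ^ k ∂hw.stieltjesFunction.measure =
      ((μ Set.univ)⁻¹).toReal * ∫ x, x ^ k ∂μ := by
    intro k
    rw [hwμ, integral_smul_measure, smul_eq_mul]
  set m : ℕ → ℝ := fun k => ∫ x, x ^ k ∂hw.stieltjesFunction.measure with hm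
  have hm0 : m 0 ≠ 0 := by
    simp only [hm]
    rw [hmom]
    exact mul_ne_zero (ENNReal.toReal_ne_zero.2 ⟨ENNReal.inv_ne_zero.2 (measure_ne_top μ _),
      ENNReal.inv_ne_top.2 hμuniv⟩) hpos.ne'
  have hσ : PowerSeries.rescale q (momentSeries q m 0) =
      quad (a + b) (a * b) * momentSeries q m 0 := by
    refine (rescale_qEgf_eq_quad_mul_iff hq0 hq1 (a + b) (a * b) m).2 ⟨?_, fun n => ?_⟩
    · simp only [hm]
      rw [hmom, hmom, hone]
      ring
    · simp only [hm]
      rw [hmom, hmom, hmom, hrec]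
      ring
  have horth := coeff_mul_momentSeries hq0 hq1 hab.ne hm0 hσ
  have hcoeff : ∀ n j, PowerSeries.coeff (n + 1) (appellSeries q Q * momentSeries q m j) =
      PowerSeries.coeff (n + 1)
        (qPochhammerSeries q a * qPochhammerSeries q b * momentSeries q m j) -
      κ * PowerSeries.coeff n
        (qPochhammerSeries q a * qPochhammerSeries q b * momentSeries q m j) := by
    intro n j
    rw [hA, mul_assoc, sub_mul, one_mul, mul_assoc (PowerSeries.C κ), map_sub,
      PowerSeries.coeff_C_mul, PowerSeries.coeff_succ_X_mul]
  have hI := integral_pow_mul_eval hint' hq0 hq1 hQ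
  refine ⟨hQ.1, Set.univ, w, hw, Set.ordConnected_univ, fun k => (hint' k).integrableOn, ?_⟩
  simp only [Measure.restrict_univ]
  refine ⟨fun n j hj => ?_, fun n j hj => ?_, ?_⟩
  · obtain ⟨n, rfl⟩ := Nat.exists_eq_add_of_le' (show 1 ≤ n by omega)
    -- The index is one more than the current `n`, so both coefficients lie above degree j.
    rw [hI, hcoeff, (horth j).1 _ (by omega), (horth j).1 _ (by omega)]
    ring
  · subst hj
    rw [hI, hcoeff, (horth j).1 _ (by omega), zero_sub]
    exact mul_ne_zero (qPochhammer_self_pos hq0 hq1 _).ne'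
      (neg_ne_zero.2 (mul_ne_zero hκ (horth j).2))
  · rw [hQ.1.zero_eq_one hmonic]
    simpa [hm] using hm0

theorem theorem3p2 (q : ℝ) (hq0 : 0 < q) (hq1 : q < 1) (Q : ℕ → Polynomial ℝ)
    (hQ : IsPolynomialSet Q) (hmonic : ∀ n, (Q n).Monic) :
    (IsQuasiOrthogonal Q ∧ IsQAppell q Q) ↔
      ∃ α β lam : ℝ, β ≠ 0 ∧ lam ≠ 0 ∧ α / β < 0 ∧
        ∀ n : ℕ, 1 ≤ n → ∀ x : ℝ, x ≠ 0 →
          (Q n).eval x =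
            β ^ n * alSalamCarlitzI n (α / β) (x / β) q -
              β ^ n * qNumber q n / lam * alSalamCarlitzI (n - 1) (α / β) (x / β) q := by
  rw [exists_alSalamCarlitz_iff hq0 hq1 hQ hmonic]
  constructor
  · rintro ⟨⟨-, I, w, hw, -, hint, hzero, hne, hne0⟩, hA⟩
    -- The measure restricted to I plays the role of μ; the shape of I does not matter.
    exact ⟨hA, exists_appellSeries_eq hq0 hq1 hmonic hA hint hzero hne hne0⟩
  · rintro ⟨hA, a, b, κ, hab, hκ, h⟩
    exact ⟨isQuasiOrthogonal_of_appellSeries_eq hq0 hq1 hmonic hA hab hκ h, hA⟩
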